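/- Let $0<\nu<1$ and $\mu=1-\nu$. For integers $0\le C_N\le N$, the Engset process $(X_N(t))_{t\ge 0}$ is the right-continuous Markov chain on $\{0,1,\ldots,C_N\}$ which jumps from $x$ to $x-1$ at rate $\mu x$ and, if $x<C_N$, from $x$ to $x+1$ at rate $\nu(N-x)$. Assume that $X_N(0)=C_N$ for all $N$, and let $T_0^{X_N}=\inf\{t\ge 0: X_N(t)=0\}$ be the hitting time of the empty state. Then, for every $N$, $T_0^{X_N}$ is almost surely finite, and the following holds. (Hitting time of the empty state, critical case.) If $C_N=\nu N+o(\sqrt N)$, then, as $N\to\infty$, the sequence $\left(N(1-\nu)^N\,T_0^{X_N}\right)$ converges in distribution to an exponential random variable with parameter $2\nu$. This is twice the rate of the sub-critical case: if instead $C_N=\eta N+O(1)$ for some real $\eta>\nu$, then $\left(N(1-\nu)^N\,T_0^{X_N}\right)$ converges in distribution to an exponential random variable with parameter $\nu$. -/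

import Mathlib

open MeasureTheory ProbabilityTheory Filter Asymptotics
open scoped Topology NNReal ENNReal

/-- `X` is a (right-continuous) continuous-time Markov chain on the finite state space `S` with
`Q`-matrix `Q`, under the probability `P`. The transition matrix over a time interval of length `s`
is `exp (s Q)`, whose entry `(x, y)` is the probability to be at `y` when starting at `x`. -/
structure IsMarkovChainWithQMatrix {Ω S : Type*} [MeasurableSpace Ω] [Fintype S] [DecidableEq S]
    [MeasurableSpace S] (Q : Matrix S S ℝ) (P : Measure Ω) (X : ℝ≥0 → Ω → S) : Prop where
  measurable : ∀ t, Measurable (X t)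
  right_continuous : ∀ᵐ ω ∂P, ∀ t, ∀ᶠ s in 𝓝[≥] t, X s ω = X t ω
  /-- For `t 0 ≤ t 1 ≤ ... ≤ t n`, the law of `(X (t 0), ..., X (t n))` is the law of `X (t 0)`
  propagated by the transition matrices. -/
  markov : ∀ (n : ℕ) (t : ℕ → ℝ≥0), Monotone t → ∀ x : ℕ → S,
    P.real {ω | ∀ k ≤ n, X (t k) ω = x k} =
      P.real {ω | X (t 0) ω = x 0} *
        ∏ k ∈ Finset.range n,
          NormedSpace.exp (((t (k + 1) : ℝ) - (t k : ℝ)) • Q) (x k) (x (k + 1))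

/-- The `Q`-matrix of the Engset process with `N` sources and capacity `C`, on `{0, ..., C}`:
rate `μ x` from `x` to `x - 1`, and rate `ν (N - x)` from `x` to `x + 1` when `x < C`. -/
noncomputable def engsetQMatrix (ν μ : ℝ) (N C : ℕ) : Matrix (Fin (C + 1)) (Fin (C + 1)) ℝ :=
  Matrix.of fun x y =>
    if (y : ℕ) + 1 = x then μ * (x : ℕ)
    else if (y : ℕ) = x + 1 then ν * ((N : ℝ) - (x : ℕ))
    else if y = x then -(μ * (x : ℕ) + if (x : ℕ) < C then ν * ((N : ℝ) - (x : ℕ)) else 0)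
    else 0

/-- `X` is an Engset process with `N` sources, capacity `C`, and rates `ν` and `μ`. -/
def IsEngsetProcess {Ω : Type*} [MeasurableSpace Ω] (ν μ : ℝ) (N C : ℕ) (P : Measure Ω)
    (X : ℝ≥0 → Ω → Fin (C + 1)) : Prop :=
  IsMarkovChainWithQMatrix (engsetQMatrix ν μ N C) P X

/-- The hitting time `inf {t ≥ 0 : X t = x}` of `x`, equal to `∞` if `x` is never visited. -/
noncomputable def hittingTimeOf {Ω S : Type*} (X : ℝ≥0 → Ω → S) (x : S) : Ω → ℝ≥0∞ :=
  hittingAfter X {x} 0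

/-! ### Derivative of the transition matrices at time zero. -/

section MatrixExp

variable {S : Type*} [Fintype S] [DecidableEq S]

attribute [local instance] Matrix.linftyOpNormedRing Matrix.linftyOpNormedAlgebra

/-! Let `v x` be the mean hitting time of `0` from `x`, so that `Q v = -1` off `0` and `v 0 = 0`. If
`a ≤ v ≤ b` off `0`, the mean of `v (X t)` on the event of survival decays at a relative rate
between `1 / b` and `1 / a`, and lies between `a` and `b` times the survival probability. Hence the
hitting time is nearly exponential as soon as `b / a` is close to `1`
(`IsMarkovChainWithQMatrix.hittingTimeOf_tail_bounds`, proved on dyadic time grids).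

For the Engset process, detailed balance with the binomial weights gives `v` explicitly; it is
increasing, so `a = v 1` and `b = v C`. The last step, from `1` to `0`, dominates: `N (1 - ν)^N v 1`
is exactly the binomial mass of `{1, ..., C}` divided by `ν`, while `N (1 - ν)^N (v C - v 1)` tends
to `0` (`mul_engsetMeanHitting_le`). If the mass tends to `c`, the limit is exponential with
parameter `ν / c`. The critical case has `c = 1 / 2` by the central limit theorem, the sub-critical
case `c = 1` by Chebyshev's inequality; this is the factor two. -/

theorem hasDerivAt_exp_smul_mulVec (Q : Matrix S S ℝ) (v : S → ℝ) (x : S) :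
    HasDerivAt (fun h : ℝ => ∑ y, NormedSpace.exp (h • Q) x y * v y) (∑ y, Q x y * v y) 0 := by
  refine HasDerivAt.fun_sum fun y _ => HasDerivAt.mul_const ?_ _
  have h := hasDerivAt_exp_smul_const (𝕂 := ℝ) Q (0 : ℝ)
  rw [zero_smul, NormedSpace.exp_zero, one_mul] at h
  exact (hasDerivAt_pi.1 (hasDerivAt_pi.1 h x)) y

end MatrixExp

/-! ### The chain killed at `z`, observed at discrete times. -/

section MarkovChain

set_option linter.unusedSectionVars false

variable {Ω S : Type*} [MeasurableSpace Ω] [Fintype S] [DecidableEq S] [MeasurableSpace S]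
  [MeasurableSingletonClass S] {Q : Matrix S S ℝ} {P : Measure Ω} [IsProbabilityMeasure P]
  {X : ℝ≥0 → Ω → S}

theorem measureReal_eq_sum_inter_eq {Y : Ω → S} (hY : Measurable Y) (B : Set Ω) :
    P.real B = ∑ s, P.real (B ∩ {ω | Y ω = s}) := by
  have h := sum_measureReal_preimage_singleton (μ := P.restrict B) (Finset.univ : Finset S) (f := Y)
    (fun y _ => hY (measurableSet_singleton y))
  rw [Finset.coe_univ, Set.preimage_univ, measureReal_restrict_apply MeasurableSet.univ,
    Set.univ_inter] at h
  rw [← h]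
  refine Finset.sum_congr rfl fun s _ => ?_
  rw [measureReal_restrict_apply (hY (measurableSet_singleton s)), Set.inter_comm]
  rfl

/-- The Markov property at the last step, given that a state `z` is avoided at the first times. -/
theorem IsMarkovChainWithQMatrix.real_avoid_cylinder_succ (hX : IsMarkovChainWithQMatrix Q P X)
    (z : S) {t : ℕ → ℝ≥0} (ht : Monotone t) (n j : ℕ) (hj : j ≤ n) (x : ℕ → S) :
    P.real {ω | (∀ k < j, X (t k) ω ≠ z) ∧ ∀ k, j ≤ k → k ≤ n + 1 → X (t k) ω = x k} =
      P.real {ω | (∀ k < j, X (t k) ω ≠ z) ∧ ∀ k, j ≤ k → k ≤ n → X (t k) ω = x k} *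
        NormedSpace.exp (((t (n + 1) : ℝ) - (t n : ℝ)) • Q) (x n) (x (n + 1)) := by
  induction j generalizing x with
  | zero =>
    have h1 := hX.markov (n + 1) t ht x
    rw [Finset.prod_range_succ, ← mul_assoc, ← hX.markov n t ht x] at h1
    simpa using h1
  | succ j ih =>
    -- Splitting by the state `s ≠ z` at time `t j` trades one avoided time for a prescribed state,
    -- recorded by updating the path at `j`.
    have key : ∀ m, j + 1 ≤ m →
        P.real {ω | (∀ k < j + 1, X (t k) ω ≠ z) ∧ ∀ k, j + 1 ≤ k → k ≤ m → X (t k) ω = x k} =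
        ∑ s ∈ Finset.univ.filter (fun s => s ≠ z),
          P.real {ω | (∀ k < j, X (t k) ω ≠ z) ∧
            ∀ k, j ≤ k → k ≤ m → X (t k) ω = Function.update x j s k} := by
      intro m hm
      rw [measureReal_eq_sum_inter_eq (hX.measurable (t j)), Finset.sum_filter]
      refine Finset.sum_congr rfl fun s _ => ?_
      split_ifs with hs
      · congr 1
        ext ω
        simp only [Set.mem_inter_iff, Set.mem_ofPred_eq]
        constructor
        · rintro ⟨⟨h1, h2⟩, h3⟩
          refine ⟨fun k hk => h1 k (by omega), fun k hk hkm => ?_⟩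
          rcases eq_or_ne k j with rfl | hne
          · simpa using h3
          · rw [Function.update_of_ne hne]
            exact h2 k (by omega) hkm
        · rintro ⟨h1, h2⟩
          have h3 : X (t j) ω = s := by simpa using h2 j le_rfl (by omega)
          refine ⟨⟨fun k hk => ?_, fun k hk hkm => ?_⟩, h3⟩
          · rcases eq_or_ne k j with rfl | hne
            · rw [h3]; exact hs
            · exact h1 k (by omega)
          · have := h2 k (by omega) hkm
            rwa [Function.update_of_ne (by omega)] at this
      · have : ({ω | (∀ k < j + 1, X (t k) ω ≠ z) ∧
            ∀ k, j + 1 ≤ k → k ≤ m → X (t k) ω = x k} ∩ {ω | X (t j) ω = s}) = ∅ := by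
          ext ω
          simp only [Set.mem_inter_iff, Set.mem_ofPred_eq, Set.mem_empty_iff_false, iff_false]
          rintro ⟨⟨h1, -⟩, h3⟩
          exact h1 j (by omega) (h3.trans (not_not.1 hs))
        rw [this, measureReal_empty]
    rw [key (n + 1) (by omega), key n hj, Finset.sum_mul]
    refine Finset.sum_congr rfl fun s _ => ?_
    rw [ih (by omega), Function.update_of_ne (by omega), Function.update_of_ne (by omega)]

/-- The probability of avoiding `z` at the times `t 0, ..., t (n - 1)` and of being at `y` at
time `t n`. -/
noncomputable def avoidProb (P : Measure Ω) (X : ℝ≥0 → Ω → S) (z : S) (t : ℕ → ℝ≥0) (n : ℕ)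
    (y : S) : ℝ :=
  P.real {ω | (∀ k < n, X (t k) ω ≠ z) ∧ X (t n) ω = y}

theorem IsMarkovChainWithQMatrix.avoidProb_succ (hX : IsMarkovChainWithQMatrix Q P X)
    (z : S) {t : ℕ → ℝ≥0} (ht : Monotone t) (n : ℕ) (y : S) :
    avoidProb P X z t (n + 1) y = ∑ x ∈ Finset.univ.filter (fun x => x ≠ z),
      avoidProb P X z t n x * NormedSpace.exp (((t (n + 1) : ℝ) - (t n : ℝ)) • Q) x y := by
  unfold avoidProb
  rw [measureReal_eq_sum_inter_eq (hX.measurable (t n)), Finset.sum_filter]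
  refine Finset.sum_congr rfl fun s _ => ?_
  split_ifs with hs
  · have h := hX.real_avoid_cylinder_succ z ht n n le_rfl (fun k => if k = n then s else y)
    simp only [if_true, show n + 1 ≠ n by omega, if_false] at h
    have e1 : ({ω | (∀ k < n + 1, X (t k) ω ≠ z) ∧ X (t (n + 1)) ω = y} ∩ {ω | X (t n) ω = s}) =
        {ω | (∀ k < n, X (t k) ω ≠ z) ∧
          ∀ k, n ≤ k → k ≤ n + 1 → X (t k) ω = if k = n then s else y} := by
      ext ω
      simp only [Set.mem_inter_iff, Set.mem_ofPred_eq]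
      constructor
      · rintro ⟨⟨h1, h2⟩, h3⟩
        refine ⟨fun k hk => h1 k (by omega), fun k hk hkm => ?_⟩
        obtain rfl | rfl : k = n ∨ k = n + 1 := by omega
        · simpa using h3
        · simpa using h2
      · rintro ⟨h1, h2⟩
        have h3 : X (t n) ω = s := by simpa using h2 n le_rfl (by omega)
        have h4 : X (t (n + 1)) ω = y := by simpa using h2 (n + 1) (by omega) (by omega)
        refine ⟨⟨fun k hk => ?_, h4⟩, h3⟩
        rcases eq_or_ne k n with rfl | hne
        · rw [h3]; exact hs
        · exact h1 k (by omega)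
    have e2 : {ω | (∀ k < n, X (t k) ω ≠ z) ∧ X (t n) ω = s} =
        {ω | (∀ k < n, X (t k) ω ≠ z) ∧
          ∀ k, n ≤ k → k ≤ n → X (t k) ω = if k = n then s else y} := by
      ext ω
      simp only [Set.mem_ofPred_eq]
      refine and_congr_right fun _ => ⟨fun h k hk hkm => ?_, fun h => ?_⟩
      · obtain rfl : k = n := by omega
        simpa using h
      · simpa using h n le_rfl le_rfl
    rw [e1, e2]
    exact h
  · have : ({ω | (∀ k < n + 1, X (t k) ω ≠ z) ∧ X (t (n + 1)) ω = y} ∩ {ω | X (t n) ω = s}) =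
        ∅ := by
      ext ω
      simp only [Set.mem_inter_iff, Set.mem_ofPred_eq, Set.mem_empty_iff_false, iff_false]
      rintro ⟨⟨h1, -⟩, h3⟩
      exact h1 n (by omega) (h3.trans (not_not.1 hs))
    rw [this, measureReal_empty]

theorem IsMarkovChainWithQMatrix.real_avoid_eq_sum (hX : IsMarkovChainWithQMatrix Q P X)
    (z : S) (t : ℕ → ℝ≥0) (n : ℕ) :
    P.real {ω | ∀ k ≤ n, X (t k) ω ≠ z} =
      ∑ x ∈ Finset.univ.filter (fun x => x ≠ z), avoidProb P X z t n x := by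
  unfold avoidProb
  rw [measureReal_eq_sum_inter_eq (hX.measurable (t n)), Finset.sum_filter]
  refine Finset.sum_congr rfl fun s _ => ?_
  split_ifs with hs
  · congr 1
    ext ω
    simp only [Set.mem_inter_iff, Set.mem_ofPred_eq]
    refine ⟨fun h => ⟨fun k hk => h.1 k hk.le, h.2⟩, fun h => ⟨fun k hk => ?_, h.2⟩⟩
    rcases hk.lt_or_eq with hk | rfl
    · exact h.1 k hk
    · rw [h.2]; exact hs
  · have : ({ω | ∀ k ≤ n, X (t k) ω ≠ z} ∩ {ω | X (t n) ω = s}) = ∅ := by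
      ext ω
      simp only [Set.mem_inter_iff, Set.mem_ofPred_eq, Set.mem_empty_iff_false, iff_false]
      rintro ⟨h1, h3⟩
      exact h1 n le_rfl (h3.trans (not_not.1 hs))
    rw [this, measureReal_empty]

/-- The expectation of `v` at time `t n` on the event that `z` has been avoided. -/
noncomputable def avoidMean (P : Measure Ω) (X : ℝ≥0 → Ω → S) (z : S) (v : S → ℝ) (t : ℕ → ℝ≥0)
    (n : ℕ) : ℝ :=
  ∑ y ∈ Finset.univ.filter (fun y => y ≠ z), avoidProb P X z t n y * v y

/-- As `v z = 0`, paths entering `z` at the last step contribute nothing, so the full transition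
matrix can act on `v`. -/
theorem IsMarkovChainWithQMatrix.avoidMean_succ (hX : IsMarkovChainWithQMatrix Q P X)
    {z : S} {v : S → ℝ} (hvz : v z = 0) {t : ℕ → ℝ≥0} (ht : Monotone t) (n : ℕ) :
    avoidMean P X z v t (n + 1) = ∑ x ∈ Finset.univ.filter (fun x => x ≠ z),
      avoidProb P X z t n x *
        ∑ y, NormedSpace.exp (((t (n + 1) : ℝ) - (t n : ℝ)) • Q) x y * v y := by
  have h1 : avoidMean P X z v t (n + 1) = ∑ y, avoidProb P X z t (n + 1) y * v y := by
    unfold avoidMean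
    rw [Finset.sum_filter]
    refine Finset.sum_congr rfl fun y _ => ?_
    split_ifs with hy
    · rfl
    · rw [not_not.1 hy, hvz, mul_zero]
  simp_rw [h1, hX.avoidProb_succ z ht, Finset.sum_mul, Finset.mul_sum]
  rw [Finset.sum_comm]
  simp_rw [mul_assoc]

theorem avoidMean_zero {z : S} {v : S → ℝ} {t : ℕ → ℝ≥0} {x₀ : S} (hx₀ : x₀ ≠ z)
    (h0 : ∀ᵐ ω ∂P, X (t 0) ω = x₀) : avoidMean P X z v t 0 = v x₀ := by
  unfold avoidMean avoidProb
  rw [Finset.sum_eq_single x₀]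
  · have : P.real {ω | (∀ k < 0, X (t k) ω ≠ z) ∧ X (t 0) ω = x₀} = 1 := by
      rw [measureReal_congr (t := Set.univ), probReal_univ]
      rw [eventuallyEq_univ]
      filter_upwards [h0] with ω hω
      exact ⟨fun k hk => absurd hk (by omega), hω⟩
    rw [this, one_mul]
  · intro y _ hy
    have : P.real {ω | (∀ k < 0, X (t k) ω ≠ z) ∧ X (t 0) ω = y} = 0 := by
      rw [measureReal_eq_zero_iff, measure_eq_zero_iff_ae_notMem]
      filter_upwards [h0] with ω hω h
      exact hy (h.2.symm.trans hω)
    rw [this, zero_mul]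
  · intro h
    exact absurd (Finset.mem_filter.2 ⟨Finset.mem_univ x₀, hx₀⟩) h

theorem avoidProb_nonneg (z : S) (t : ℕ → ℝ≥0) (n : ℕ) (y : S) : 0 ≤ avoidProb P X z t n y :=
  measureReal_nonneg

theorem IsMarkovChainWithQMatrix.avoidMean_le (hX : IsMarkovChainWithQMatrix Q P X)
    {z : S} {v : S → ℝ} (hvz : v z = 0) {h : ℝ≥0} {ρ : ℝ} (hρ0 : 0 ≤ ρ)
    (hρ : ∀ x, x ≠ z → ∑ y, NormedSpace.exp ((h : ℝ) • Q) x y * v y ≤ ρ * v x) (n : ℕ) :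
    avoidMean P X z v (fun k => k * h) n ≤ ρ ^ n * avoidMean P X z v (fun k => k * h) 0 := by
  induction n with
  | zero => simp
  | succ n ih =>
    have ht : Monotone (fun k : ℕ => (k : ℝ≥0) * h) := fun i j hij => by dsimp only; gcongr
    rw [hX.avoidMean_succ hvz ht]
    have hh : (((((n + 1 : ℕ) : ℝ≥0) * h : ℝ≥0) : ℝ) - (((n : ℝ≥0) * h : ℝ≥0) : ℝ)) = h := by
      push_cast; ring
    rw [hh]
    calc _ ≤ ∑ x ∈ Finset.univ.filter (fun x => x ≠ z),
          avoidProb P X z (fun k => k * h) n x * (ρ * v x) :=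
          Finset.sum_le_sum fun x hx => mul_le_mul_of_nonneg_left
            (hρ x (Finset.mem_filter.1 hx).2) (avoidProb_nonneg _ _ _ _)
      _ = ρ * avoidMean P X z v (fun k => k * h) n := by
          unfold avoidMean
          rw [Finset.mul_sum]
          exact Finset.sum_congr rfl fun x _ => by ring
      _ ≤ _ := by
          rw [pow_succ', mul_assoc]
          exact mul_le_mul_of_nonneg_left ih hρ0

theorem IsMarkovChainWithQMatrix.le_avoidMean (hX : IsMarkovChainWithQMatrix Q P X)
    {z : S} {v : S → ℝ} (hvz : v z = 0) {h : ℝ≥0} {σ : ℝ} (hσ0 : 0 ≤ σ)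
    (hσ : ∀ x, x ≠ z → σ * v x ≤ ∑ y, NormedSpace.exp ((h : ℝ) • Q) x y * v y) (n : ℕ) :
    σ ^ n * avoidMean P X z v (fun k => k * h) 0 ≤ avoidMean P X z v (fun k => k * h) n := by
  induction n with
  | zero => simp
  | succ n ih =>
    have ht : Monotone (fun k : ℕ => (k : ℝ≥0) * h) := fun i j hij => by dsimp only; gcongr
    rw [hX.avoidMean_succ hvz ht]
    have hh : (((((n + 1 : ℕ) : ℝ≥0) * h : ℝ≥0) : ℝ) - (((n : ℝ≥0) * h : ℝ≥0) : ℝ)) = h := by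
      push_cast; ring
    rw [hh]
    calc _ ≤ σ * avoidMean P X z v (fun k => k * h) n := by
          rw [pow_succ', mul_assoc]
          exact mul_le_mul_of_nonneg_left ih hσ0
      _ = ∑ x ∈ Finset.univ.filter (fun x => x ≠ z),
          avoidProb P X z (fun k => k * h) n x * (σ * v x) := by
          unfold avoidMean
          rw [Finset.mul_sum]
          exact Finset.sum_congr rfl fun x _ => by ring
      _ ≤ _ := Finset.sum_le_sum fun x hx => mul_le_mul_of_nonneg_left
            (hσ x (Finset.mem_filter.1 hx).2) (avoidProb_nonneg _ _ _ _)

end MarkovChain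

/-! ### Hitting times of right-continuous paths. -/

section HittingTime

variable {Ω S : Type*} {X : ℝ≥0 → Ω → S} {z : S} {ω : Ω}

/-- Right continuity makes the infimum a minimum: the path is constant just after it, on an interval
that contains visits to `z`. -/
theorem hittingTimeOf_le_iff (hω : ∀ t, ∀ᶠ s in 𝓝[≥] t, X s ω = X t ω) (t : ℝ≥0) :
    hittingTimeOf X z ω ≤ t ↔ ∃ s ≤ t, X s ω = z := by
  unfold hittingTimeOf
  rw [hittingAfter_def]
  dsimp only
  split_ifs with h
  · set A : Set ℝ≥0 := {i | X i ω = z} with hA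
    have hA' : {i : ℝ≥0 | 0 ≤ i ∧ X i ω ∈ ({z} : Set S)} = A := by ext i; simp [hA]
    rw [hA']
    have hne : A.Nonempty := by
      obtain ⟨i, -, hi⟩ := h
      exact ⟨i, hi⟩
    have hmem : sInf A ∈ A := by
      obtain ⟨u, hu, hsub⟩ := (mem_nhdsGE_iff_exists_Ico_subset' (lt_add_one (sInf A))).1
        (hω (sInf A))
      obtain ⟨s, hsA, hsu⟩ := exists_lt_of_csInf_lt hne hu
      have h1 : X s ω = X (sInf A) ω := hsub ⟨csInf_le (OrderBot.bddBelow _) hsA, hsu⟩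
      exact h1.symm.trans hsA
    have : ((sInf A : ℝ≥0) : ℝ≥0∞) ≤ t ↔ sInf A ≤ t := ENNReal.coe_le_coe
    refine this.trans ⟨fun hle => ⟨_, hle, hmem⟩, ?_⟩
    rintro ⟨s, hst, hs⟩
    exact (csInf_le (OrderBot.bddBelow A) (show s ∈ A from hs)).trans hst
  · refine ⟨fun hle => ?_, fun ⟨s, _, hs⟩ => absurd ⟨s, zero_le, hs⟩ h⟩
    exact absurd (show (⊤ : ℝ≥0∞) ≤ t from hle) (by simp)

/-- The path stays constant on some `[s, u)`; a dyadic grid of `[0, t]` with mesh less than `u - s`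
has a point there, namely `s` rounded up. -/
theorem exists_dyadic_eq (hω : ∀ t, ∀ᶠ s in 𝓝[≥] t, X s ω = X t ω) {s t : ℝ≥0} (hst : s ≤ t) :
    ∃ j : ℕ, ∃ k : ℕ, k ≤ 2 ^ j ∧ X (k * (t / ((2 ^ j : ℕ) : ℝ≥0))) ω = X s ω := by
  rcases eq_or_ne t 0 with rfl | ht
  · exact ⟨0, 0, by simp, by rw [show s = 0 from le_antisymm hst zero_le]; simp⟩
  obtain ⟨u, hu, hsub⟩ := (mem_nhdsGE_iff_exists_Ico_subset' (lt_add_one s)).1 (hω s)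
  have hu' : (s : ℝ) < u := hu
  have ht' : (0 : ℝ) < t := by positivity
  obtain ⟨j, hj⟩ := pow_unbounded_of_one_lt ((t : ℝ) / (u - s)) (one_lt_two)
  have h2 : (0 : ℝ) < 2 ^ j := by positivity
  set h : ℝ := (t : ℝ) / 2 ^ j with hh
  have hpos : 0 < h := by positivity
  have hlt : h < u - s := by
    rw [div_lt_iff₀ (by linarith)] at hj
    rw [hh, div_lt_iff₀ h2]
    linarith
  refine ⟨j, ⌈(s : ℝ) / h⌉₊, ?_, ?_⟩
  · rw [Nat.ceil_le, div_le_iff₀ hpos, hh]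
    push_cast
    rw [mul_div_cancel₀ _ h2.ne']
    exact_mod_cast hst
  · apply hsub
    have h3 := Nat.le_ceil ((s : ℝ) / h)
    have h4 := Nat.ceil_lt_add_one (show 0 ≤ (s : ℝ) / h by positivity)
    rw [div_le_iff₀ hpos] at h3
    have h5 : (⌈(s : ℝ) / h⌉₊ : ℝ) * h < u := by
      have := mul_lt_mul_of_pos_right h4 hpos
      rw [add_mul, div_mul_cancel₀ _ hpos.ne'] at this
      linarith
    constructor
    · rw [← NNReal.coe_le_coe]; push_cast; exact h3
    · rw [← NNReal.coe_lt_coe]; push_cast; exact h5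

theorem lt_hittingTimeOf_iff_dyadic (hω : ∀ t, ∀ᶠ s in 𝓝[≥] t, X s ω = X t ω) (t : ℝ≥0) :
    (t : ℝ≥0∞) < hittingTimeOf X z ω ↔
      ∀ j : ℕ, ∀ k : ℕ, k ≤ 2 ^ j → X (k * (t / ((2 ^ j : ℕ) : ℝ≥0))) ω ≠ z := by
  rw [← not_le, hittingTimeOf_le_iff hω]
  refine ⟨fun h j k hk hX => h ⟨_, ?_, hX⟩, ?_⟩
  · rw [← mul_div_assoc]
    refine div_le_of_le_mul₀ zero_le zero_le ?_
    rw [mul_comm]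
    gcongr
  · rintro h ⟨s, hst, hs⟩
    obtain ⟨j, k, hk, hjk⟩ := exists_dyadic_eq hω hst
    exact h j k hk (hjk.trans hs)

/-- A countable infimum, for measurability. Negative rationals merely repeat time `0`. -/
theorem hittingTimeOf_eq_iInf (hω : ∀ t, ∀ᶠ s in 𝓝[≥] t, X s ω = X t ω) [DecidableEq S] :
    hittingTimeOf X z ω =
      ⨅ q : ℚ, if X (q : ℝ).toNNReal ω = z then ((q : ℝ).toNNReal : ℝ≥0∞) else ∞ := by
  apply le_antisymm
  · refine le_iInf fun q => ?_
    split_ifs with h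
    · exact (hittingTimeOf_le_iff hω _).2 ⟨_, le_rfl, h⟩
    · exact le_top
  · refine le_of_forall_gt fun c hc => ?_
    obtain ⟨t, ht1, ht2⟩ := ENNReal.lt_iff_exists_nnreal_btwn.1 hc
    obtain ⟨s, hst, hs⟩ := (hittingTimeOf_le_iff hω t).1 ht1.le
    obtain ⟨d, hd1, hd2⟩ := ENNReal.lt_iff_exists_nnreal_btwn.1 ht2
    have hsd : s < d := hst.trans_lt (by exact_mod_cast hd1)
    obtain ⟨u, hu, hsub⟩ := (mem_nhdsGE_iff_exists_Ico_subset' hsd).1 (hω s)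
    obtain ⟨q, hq1, hq2⟩ := exists_rat_btwn (show (s : ℝ) < min u d from lt_min hu hsd)
    have hq0 : 0 ≤ q := by exact_mod_cast s.2.trans hq1.le
    have hq : ((q : ℝ).toNNReal : ℝ) = q := Real.coe_toNNReal _ (by exact_mod_cast hq0)
    have h1 : s < (q : ℝ).toNNReal := by rw [← NNReal.coe_lt_coe, hq]; exact hq1
    have h2 : (q : ℝ).toNNReal < u := by
      rw [← NNReal.coe_lt_coe, hq]; exact hq2.trans_le (min_le_left _ _)
    have h3 : (q : ℝ).toNNReal < d := by
      rw [← NNReal.coe_lt_coe, hq]; exact hq2.trans_le (min_le_right _ _)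
    refine (iInf_le _ q).trans_lt ?_
    rw [if_pos ((hsub ⟨h1.le, h2⟩ : X _ ω = X s ω).trans hs)]
    exact lt_trans (by exact_mod_cast h3) hd2

end HittingTime

/-! ### Measurability, and survival as a limit along dyadic grids. -/

section MarkovChain

variable {Ω S : Type*} [MeasurableSpace Ω] [Fintype S] [DecidableEq S] [MeasurableSpace S]
  [MeasurableSingletonClass S] {Q : Matrix S S ℝ} {P : Measure Ω}
  {X : ℝ≥0 → Ω → S}

theorem IsMarkovChainWithQMatrix.aemeasurable_hittingTimeOf
    (hX : IsMarkovChainWithQMatrix Q P X) (z : S) : AEMeasurable (hittingTimeOf X z) P := by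
  refine ⟨fun ω => ⨅ q : ℚ, if X (q : ℝ).toNNReal ω = z then ((q : ℝ).toNNReal : ℝ≥0∞) else ∞, ?_, ?_⟩
  · exact Measurable.iInf fun q => Measurable.ite
      (hX.measurable _ (measurableSet_singleton z)) measurable_const measurable_const
  · filter_upwards [hX.right_continuous] with ω hω
    exact hittingTimeOf_eq_iInf hω

variable [IsProbabilityMeasure P]

theorem IsMarkovChainWithQMatrix.tendsto_real_avoid_dyadic
    (hX : IsMarkovChainWithQMatrix Q P X) (z : S) (t : ℝ≥0) :
    Tendsto (fun j : ℕ => P.real {ω | ∀ k : ℕ, k ≤ 2 ^ j → X (k * (t / ((2 ^ j : ℕ) : ℝ≥0))) ω ≠ z}) atTop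
      (𝓝 (P.real {ω | (t : ℝ≥0∞) < hittingTimeOf X z ω})) := by
  have h1 : P.real {ω | (t : ℝ≥0∞) < hittingTimeOf X z ω} =
      P.real (⋂ j : ℕ, {ω | ∀ k : ℕ, k ≤ 2 ^ j → X (k * (t / ((2 ^ j : ℕ) : ℝ≥0))) ω ≠ z}) := by
    rw [← Set.ofPred_forall]
    apply measureReal_congr
    filter_upwards [hX.right_continuous] with ω hω
    exact propext (lt_hittingTimeOf_iff_dyadic (z := z) hω t)
  rw [h1]
  refine (ENNReal.tendsto_toReal (measure_ne_top _ _)).comp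
    (tendsto_measure_iInter_atTop (fun j => ?_) ?_ ⟨0, measure_ne_top _ _⟩)
  · refine MeasurableSet.nullMeasurableSet ?_
    have : {ω | ∀ k : ℕ, k ≤ 2 ^ j → X (k * (t / ((2 ^ j : ℕ) : ℝ≥0))) ω ≠ z} =
        ⋂ k : ℕ, ⋂ _ : k ≤ 2 ^ j, (X (k * (t / ((2 ^ j : ℕ) : ℝ≥0)))) ⁻¹' {z}ᶜ := by
      ext ω; simp
    rw [this]
    exact MeasurableSet.iInter fun k => MeasurableSet.iInter fun _ =>
      hX.measurable _ (measurableSet_singleton z).compl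
  -- The grids are nested: point `k` of level `j` is point `2 * k` of level `j + 1`.
  · refine antitone_nat_of_succ_le fun j ω hω k hk => ?_
    have := hω (2 * k) (by rw [pow_succ]; omega)
    have h2 : ((2 * k : ℕ) : ℝ≥0) * (t / ((2 ^ (j + 1) : ℕ) : ℝ≥0)) =
        k * (t / ((2 ^ j : ℕ) : ℝ≥0)) := by
      push_cast
      rw [pow_succ]
      field_simp
    rwa [h2] at this

end MarkovChain

/-! ### Exponential bounds for the tail of a hitting time. -/

section MarkovChain

set_option linter.unusedSectionVars false

variable {Ω S : Type*} [MeasurableSpace Ω] [Fintype S] [DecidableEq S] [MeasurableSpace S]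
  [MeasurableSingletonClass S] {Q : Matrix S S ℝ} {P : Measure Ω} [IsProbabilityMeasure P]
  {X : ℝ≥0 → Ω → S}

theorem tendsto_mul_abs_exp_sub_sub (Q : Matrix S S ℝ) (v : S → ℝ) (x : S)
    (hQ : ∑ y, Q x y * v y = -1) (t : ℝ) :
    Tendsto (fun m : ℕ =>
      (m : ℝ) * |∑ y, NormedSpace.exp ((t / m) • Q) x y * v y - v x + t / m|) atTop (𝓝 0) := by
  have h1 := (hasDerivAt_exp_smul_mulVec Q v x).isLittleO
  rw [hQ] at h1
  have ht : Tendsto (fun m : ℕ => t / (m : ℝ)) atTop (𝓝 0) := tendsto_const_div_atTop_nhds_zero_nat t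
  have h2 := h1.comp_tendsto ht
  have h3 : (fun m : ℕ => t / (m : ℝ) - 0) =O[atTop] (fun m : ℕ => ((m : ℝ))⁻¹) := by
    simp_rw [sub_zero, div_eq_mul_inv]
    exact (isBigO_refl _ _).const_mul_left t
  have h4 := h2.trans_isBigO h3
  rw [isLittleO_iff_tendsto'] at h4
  · refine (tendsto_zero_iff_abs_tendsto_zero _).1 h4 |>.congr fun m => ?_
    simp only [Function.comp_apply, zero_smul, NormedSpace.exp_zero, Matrix.one_apply, ite_mul,
      one_mul, zero_mul, Finset.sum_ite_eq, Finset.mem_univ, if_true, smul_eq_mul]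
    rw [abs_div, abs_inv, Nat.abs_cast, div_inv_eq_mul, mul_comm]
    congr 2
    ring
  · filter_upwards [eventually_gt_atTop 0] with m hm h
    have : (0 : ℝ) < m := by exact_mod_cast hm
    simp [this.ne'] at h

/-- If the mean hitting times `v` of the state `z` are between `a` and `b`, the hitting time of `z`
is nearly exponential. -/
theorem IsMarkovChainWithQMatrix.hittingTimeOf_tail_bounds (hX : IsMarkovChainWithQMatrix Q P X)
    {z x₀ : S} (hx₀ : x₀ ≠ z) (h0 : ∀ᵐ ω ∂P, X 0 ω = x₀) {v : S → ℝ} {a b : ℝ} (ha : 0 < a)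
    (hvz : v z = 0) (hva : ∀ x, x ≠ z → a ≤ v x) (hvb : ∀ x, x ≠ z → v x ≤ b)
    (hQ : ∀ x, x ≠ z → ∑ y, Q x y * v y = -1) (t : ℝ≥0) :
    Real.exp (-(t / a)) * v x₀ ≤ b * P.real {ω | (t : ℝ≥0∞) < hittingTimeOf X z ω} ∧
      a * P.real {ω | (t : ℝ≥0∞) < hittingTimeOf X z ω} ≤ Real.exp (-(t / b)) * v x₀ := by
  have hb : 0 < b := ha.trans_le ((hva x₀ hx₀).trans (hvb x₀ hx₀))
  set A : Finset S := Finset.univ.filter (fun x => x ≠ z) with hA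
  -- A bound, uniform over states, for the error in `exp (h Q) v ≈ v - h` with `h = t / m`. It is
  -- `o(1 / m)`, so it vanishes even after `m` steps.
  set g : ℕ → ℝ := fun m =>
    ∑ x ∈ A, |∑ y, NormedSpace.exp (((t : ℝ) / m) • Q) x y * v y - v x + t / m| with hg
  have hg0 : ∀ m, 0 ≤ g m := fun m => Finset.sum_nonneg fun _ _ => abs_nonneg _
  have hglim : Tendsto (fun m : ℕ => (m : ℝ) * g m) atTop (𝓝 0) := by
    simp_rw [hg, Finset.mul_sum]
    rw [← Finset.sum_const_zero (s := A) (M := ℝ)]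
    exact tendsto_finsetSum _ fun x hx =>
      tendsto_mul_abs_exp_sub_sub Q v x (hQ x (Finset.mem_filter.1 hx).2) t
  have hgx : ∀ (m : ℕ) (x : S), x ≠ z →
      |∑ y, NormedSpace.exp (((t : ℝ) / m) • Q) x y * v y - v x + t / m| ≤ g m := fun m x hx =>
    Finset.single_le_sum
      (f := fun x => |∑ y, NormedSpace.exp (((t : ℝ) / m) • Q) x y * v y - v x + t / m|)
      (fun _ _ => abs_nonneg _) (Finset.mem_filter.2 ⟨Finset.mem_univ x, hx⟩)
  -- From `v ≤ b` and `a ≤ v`, one step gives `v - h + g ≤ (1 - h / b + g / a) v`; the `m`-th power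
  -- of this factor tends to `exp (-t / b)`. The lower bound is symmetric.
  have hρ : Tendsto (fun m : ℕ => (m : ℝ) * (-(t / m / b) + g m / a)) atTop (𝓝 (-(t / b))) := by
    have h1 : Tendsto (fun m : ℕ => -((t : ℝ) / b) + (m : ℝ) * g m / a) atTop
        (𝓝 (-(t / b) + 0 / a)) := tendsto_const_nhds.add (hglim.div_const a)
    rw [zero_div, add_zero] at h1
    refine h1.congr' ?_
    filter_upwards [eventually_gt_atTop 0] with m hm
    have : (0 : ℝ) < m := by exact_mod_cast hm
    field_simp
  have hσ : Tendsto (fun m : ℕ => (m : ℝ) * (-(t / m / a) - g m / a)) atTop (𝓝 (-(t / a))) := by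
    have h1 : Tendsto (fun m : ℕ => -((t : ℝ) / a) - (m : ℝ) * g m / a) atTop
        (𝓝 (-(t / a) - 0 / a)) := tendsto_const_nhds.sub (hglim.div_const a)
    rw [zero_div, sub_zero] at h1
    refine h1.congr' ?_
    filter_upwards [eventually_gt_atTop 0] with m hm
    have : (0 : ℝ) < m := by exact_mod_cast hm
    field_simp
  have hρ' := Real.tendsto_one_add_pow_exp_of_tendsto hρ
  have hσ' := Real.tendsto_one_add_pow_exp_of_tendsto hσ
  have hpos : ∀ {u : ℕ → ℝ} {c : ℝ}, Tendsto (fun m : ℕ => (m : ℝ) * u m) atTop (𝓝 c) →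
      ∀ᶠ m in atTop, 0 ≤ 1 + u m := by
    intro u c hu
    have h1 : Tendsto (fun m : ℕ => (m : ℝ)⁻¹ * ((m : ℝ) * u m)) atTop (𝓝 (0 * c)) :=
      (tendsto_inv_atTop_nhds_zero_nat).mul hu
    rw [zero_mul] at h1
    filter_upwards [h1.eventually (lt_mem_nhds (show (-1 : ℝ) < 0 by norm_num)),
      eventually_gt_atTop 0] with m hm hm0
    have : (m : ℝ) ≠ 0 := by exact_mod_cast hm0.ne'
    rw [inv_mul_cancel_left₀ this] at hm
    linarith
  have hV0 : ∀ m : ℕ, avoidMean P X z v (fun k => k * (t / (m : ℝ≥0))) 0 = v x₀ := fun m =>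
    avoidMean_zero hx₀ (by simpa using h0)
  have hcast : ∀ m : ℕ, (((t / (m : ℝ≥0) : ℝ≥0)) : ℝ) = t / m := fun m => by push_cast; rfl
  set p : ℕ → ℝ := fun m => P.real {ω | ∀ k : ℕ, k ≤ m → X (k * (t / (m : ℝ≥0))) ω ≠ z} with hp
  have hpow : Tendsto (fun j : ℕ => 2 ^ j) atTop (atTop : Filter ℕ) :=
    tendsto_pow_atTop_atTop_of_one_lt one_lt_two
  have hplim : Tendsto (fun j : ℕ => p (2 ^ j)) atTop
      (𝓝 (P.real {ω | (t : ℝ≥0∞) < hittingTimeOf X z ω})) := hX.tendsto_real_avoid_dyadic z t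
  have hpsum : ∀ m : ℕ, p m = ∑ x ∈ A, avoidProb P X z (fun k => k * (t / (m : ℝ≥0))) m x :=
    fun m => hX.real_avoid_eq_sum z (fun k => k * (t / (m : ℝ≥0))) m
  constructor
  · refine le_of_tendsto_of_tendsto ((hσ'.comp hpow).mul_const (v x₀)) (hplim.const_mul b) ?_
    filter_upwards [hpow.eventually (hpos hσ)] with j hj
    rw [Function.comp_apply]
    generalize 2 ^ j = m at hj ⊢
    have h1 := hX.le_avoidMean hvz (h := t / (m : ℝ≥0)) hj (fun x hx => by
      have h2 := neg_le_of_abs_le (hgx m x hx)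
      have h3 : 1 ≤ v x / a := (one_le_div ha).2 (hva x hx)
      have h4 : (0 : ℝ) ≤ t / m := by positivity
      have h5 := mul_le_mul_of_nonneg_right h3 (add_nonneg h4 (hg0 m))
      have h6 : (1 + (-((t : ℝ) / m / a) - g m / a)) * v x = v x - v x / a * (t / m + g m) := by
        field_simp
        ring
      rw [hcast, h6]
      linarith) m
    rw [hV0] at h1
    refine h1.trans ?_
    rw [hpsum, Finset.mul_sum]
    unfold avoidMean
    exact Finset.sum_le_sum fun x hx => by
      rw [mul_comm b]
      exact mul_le_mul_of_nonneg_left (hvb x (Finset.mem_filter.1 hx).2) (avoidProb_nonneg _ _ _ _)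
  · refine le_of_tendsto_of_tendsto (hplim.const_mul a) ((hρ'.comp hpow).mul_const (v x₀)) ?_
    filter_upwards [hpow.eventually (hpos hρ)] with j hj
    rw [Function.comp_apply]
    generalize 2 ^ j = m at hj ⊢
    have h1 := hX.avoidMean_le hvz (h := t / (m : ℝ≥0)) hj (fun x hx => by
      have h2 := le_of_abs_le (hgx m x hx)
      have h3 : v x / b ≤ 1 := (div_le_one hb).2 (hvb x hx)
      have h3' : 1 ≤ v x / a := (one_le_div ha).2 (hva x hx)
      have h4 : (0 : ℝ) ≤ t / m := by positivity
      have h5 := mul_le_mul_of_nonneg_right h3 h4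
      have h5' := mul_le_mul_of_nonneg_right h3' (hg0 m)
      have h6 : (1 + (-((t : ℝ) / m / b) + g m / a)) * v x =
          v x - v x / b * (t / m) + v x / a * g m := by
        field_simp
        ring
      rw [hcast, h6]
      linarith) m
    rw [hV0] at h1
    refine le_trans ?_ h1
    rw [hpsum, Finset.mul_sum]
    unfold avoidMean
    exact Finset.sum_le_sum fun x hx => by
      rw [mul_comm a]
      exact mul_le_mul_of_nonneg_left (hva x (Finset.mem_filter.1 hx).2) (avoidProb_nonneg _ _ _ _)

end MarkovChain

/-! ### Explicit mean hitting times of the Engset process. -/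

section Engset

/-- The weight of `x` under the binomial distribution with parameters `N` and `ν`. -/
noncomputable def binomialWeight (ν : ℝ) (N x : ℕ) : ℝ :=
  N.choose x * ν ^ x * (1 - ν) ^ (N - x)

/-- The mean time that the Engset process needs to go from `x` to `x - 1`. -/
noncomputable def engsetStepMean (ν : ℝ) (N C x : ℕ) : ℝ :=
  (∑ y ∈ Finset.Icc x C, binomialWeight ν N y) / (binomialWeight ν N x * ((1 - ν) * x))

/-- The mean time that the Engset process needs to go from `x` to `0`. -/
noncomputable def engsetMeanHitting (ν : ℝ) (N C x : ℕ) : ℝ :=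
  ∑ j ∈ Finset.Icc 1 x, engsetStepMean ν N C j

variable {ν : ℝ} {N C : ℕ}

theorem binomialWeight_pos (hν0 : 0 < ν) (hν1 : ν < 1) {x : ℕ} (hx : x ≤ N) :
    0 < binomialWeight ν N x := by
  have h1 : 0 < 1 - ν := by linarith
  have h2 : (0 : ℝ) < N.choose x := by exact_mod_cast Nat.choose_pos hx
  unfold binomialWeight
  positivity

theorem binomialWeight_nonneg (hν0 : 0 < ν) (hν1 : ν < 1) (x : ℕ) :
    0 ≤ binomialWeight ν N x := by
  have h1 : 0 < 1 - ν := by linarith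
  unfold binomialWeight
  positivity

/-- Detailed balance: the binomial law is reversible for these rates. -/
theorem binomialWeight_succ {x : ℕ} (hx : x < N) :
    binomialWeight ν N (x + 1) * ((1 - ν) * ((x + 1 : ℕ) : ℝ)) =
      binomialWeight ν N x * (ν * ((N : ℝ) - x)) := by
  have h1 : (N.choose (x + 1) : ℝ) * ((x + 1 : ℕ) : ℝ) = N.choose x * ((N : ℝ) - x) := by
    rw [← Nat.cast_sub hx.le]
    exact_mod_cast Nat.choose_succ_right_eq N x
  have h2 : N - x = N - (x + 1) + 1 := by omega
  unfold binomialWeight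
  rw [h2, pow_succ, pow_succ]
  linear_combination ν ^ x * ν * (1 - ν) ^ (N - (x + 1)) * (1 - ν) * h1

theorem sum_binomialWeight (ν : ℝ) (N : ℕ) :
    ∑ x ∈ Finset.range (N + 1), binomialWeight ν N x = 1 := by
  have h := add_pow ν (1 - ν) N
  rw [add_sub_cancel, one_pow] at h
  rw [h]
  exact Finset.sum_congr rfl fun x _ => by unfold binomialWeight; ring

theorem sum_binomialWeight_le_one (hν0 : 0 < ν) (hν1 : ν < 1) (hC : C ≤ N) (x : ℕ) :
    ∑ y ∈ Finset.Icc x C, binomialWeight ν N y ≤ 1 := by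
  rw [← sum_binomialWeight ν N]
  refine Finset.sum_le_sum_of_subset_of_nonneg (fun y hy => ?_)
    fun y _ _ => binomialWeight_nonneg hν0 hν1 y
  rw [Finset.mem_Icc] at hy
  rw [Finset.mem_range]
  omega

/-- The truncated `x - 1` is harmless at `x = 0`, where its coefficient `μ * x` vanishes. -/
theorem sum_engsetQMatrix_mul (ν μ : ℝ) (N C : ℕ) (x : Fin (C + 1)) (f : ℕ → ℝ) :
    ∑ y, engsetQMatrix ν μ N C x y * f y =
      μ * (x : ℕ) * (f ((x : ℕ) - 1) - f x) +
        if (x : ℕ) < C then ν * ((N : ℝ) - (x : ℕ)) * (f ((x : ℕ) + 1) - f x) else 0 := by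
  have hx := x.2
  set d : ℝ := μ * (x : ℕ) + if (x : ℕ) < C then ν * ((N : ℝ) - (x : ℕ)) else 0 with hd
  set F : ℕ → ℝ := fun y => (if y + 1 = x then μ * (x : ℕ) * f y else 0) +
        (if y = x + 1 then ν * ((N : ℝ) - (x : ℕ)) * f y else 0) +
        (if y = x then -d * f y else 0) with hF
  have h1 : ∀ y : Fin (C + 1), engsetQMatrix ν μ N C x y * f y = F y := by
    intro y
    simp only [hF]
    unfold engsetQMatrix
    rw [Matrix.of_apply]
    simp only [Fin.ext_iff]
    rw [← hd]
    clear_value d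
    split_ifs <;> first | omega | ring
  simp_rw [h1]
  rw [Fin.sum_univ_eq_sum_range F, hF, Finset.sum_add_distrib, Finset.sum_add_distrib,
    Finset.sum_ite_eq' (Finset.range (C + 1)) (x : ℕ),
    Finset.sum_ite_eq' (Finset.range (C + 1)) ((x : ℕ) + 1)]
  have h2 : ∑ y ∈ Finset.range (C + 1), (if y + 1 = (x : ℕ) then μ * (x : ℕ) * f y else 0) =
      μ * (x : ℕ) * f ((x : ℕ) - 1) := by
    rcases Nat.eq_zero_or_pos (x : ℕ) with h0 | h0
    · simp [h0]
    · rw [Finset.sum_eq_single ((x : ℕ) - 1)]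
      · rw [if_pos (by omega)]
      · intro y _ hy
        rw [if_neg (by omega)]
      · intro h
        exact absurd (Finset.mem_range.2 (by omega)) h
  rw [h2]
  simp only [Finset.mem_range, hx, if_true, add_lt_add_iff_right]
  split_ifs at hd ⊢ <;> rw [hd] <;> ring

/-- Let `w` be the weights and `S n` their sum over `[n, C]`. By detailed balance the upward term is
`S (n + 1) / w n` and the downward term `-S n / w n`; they add up to `-1`. At `n = C` only the
latter remains, with `S C = w C`. -/
theorem sum_engsetQMatrix_mul_meanHitting (hν0 : 0 < ν) (hν1 : ν < 1) (hC : C ≤ N)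
    (x : Fin (C + 1)) (hx : x ≠ 0) :
    ∑ y, engsetQMatrix ν (1 - ν) N C x y * engsetMeanHitting ν N C y = -1 := by
  rw [sum_engsetQMatrix_mul ν (1 - ν) N C x (engsetMeanHitting ν N C)]
  have hx0 : (x : ℕ) ≠ 0 := fun h => hx (Fin.ext h)
  have hxC := x.2
  generalize (x : ℕ) = n at hx0 hxC ⊢
  have hμ : 0 < 1 - ν := by linarith
  have hn : (0 : ℝ) < n := by exact_mod_cast Nat.pos_of_ne_zero hx0
  have hw := binomialWeight_pos hν0 hν1 (show n ≤ N by omega)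
  have hstep : ∀ m, engsetMeanHitting ν N C (m + 1) =
      engsetMeanHitting ν N C m + engsetStepMean ν N C (m + 1) := fun m =>
    Finset.sum_Icc_succ_top (by omega) _
  have h1 : engsetMeanHitting ν N C (n - 1) - engsetMeanHitting ν N C n =
      - engsetStepMean ν N C n := by
    have := hstep (n - 1)
    rw [show n - 1 + 1 = n by omega] at this
    rw [this]; ring
  rw [h1, hstep n, add_sub_cancel_left]
  unfold engsetStepMean
  split_ifs with hlt
  · have hw' := binomialWeight_pos hν0 hν1 (show n + 1 ≤ N by omega)
    have hNn : (0 : ℝ) < (N : ℝ) - n := by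
      rw [sub_pos]; exact_mod_cast (show n < N by omega)
    rw [binomialWeight_succ (show n < N by omega),
      ← Finset.add_sum_Ioc_eq_sum_Icc (f := binomialWeight ν N) (show n ≤ C by omega)]
    rw [show Finset.Ioc n C = Finset.Icc (n + 1) C from (Order.succ_eq_add_one n ▸
      (Finset.Icc_succ_left_eq_Ioc n C)).symm]
    field_simp
    ring
  · obtain rfl : n = C := by omega
    rw [Finset.Icc_self, Finset.sum_singleton, add_zero]
    field_simp

theorem engsetStepMean_nonneg (hν0 : 0 < ν) (hν1 : ν < 1) (x : ℕ) :
    0 ≤ engsetStepMean ν N C x := by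
  have hμ : 0 < 1 - ν := by linarith
  exact div_nonneg (Finset.sum_nonneg fun y _ => binomialWeight_nonneg hν0 hν1 y)
    (mul_nonneg (binomialWeight_nonneg hν0 hν1 x) (by positivity))

theorem engsetMeanHitting_mono (hν0 : 0 < ν) (hν1 : ν < 1) :
    Monotone (engsetMeanHitting ν N C) := fun _ _ hxy =>
  Finset.sum_le_sum_of_subset_of_nonneg (Finset.Icc_subset_Icc_right hxy)
    fun j _ _ => engsetStepMean_nonneg hν0 hν1 j

theorem engsetMeanHitting_one_pos (hν0 : 0 < ν) (hν1 : ν < 1) (hC1 : 1 ≤ C) (hC : C ≤ N) :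
    0 < engsetMeanHitting ν N C 1 := by
  have hμ : 0 < 1 - ν := by linarith
  unfold engsetMeanHitting engsetStepMean
  rw [Finset.Icc_self, Finset.sum_singleton]
  refine div_pos (Finset.sum_pos (fun y hy => binomialWeight_pos hν0 hν1
    ((Finset.mem_Icc.1 hy).2.trans hC)) ⟨1, Finset.mem_Icc.2 ⟨le_rfl, hC1⟩⟩)
    (mul_pos (binomialWeight_pos hν0 hν1 (hC1.trans hC)) (by simpa using hμ))

theorem IsEngsetProcess.hittingTimeOf_tail_bounds {Ω : Type*} [MeasurableSpace Ω] {P : Measure Ω}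
    [IsProbabilityMeasure P] {X : ℝ≥0 → Ω → Fin (C + 1)} (hν0 : 0 < ν) (hν1 : ν < 1)
    (hC1 : 1 ≤ C) (hC : C ≤ N) (hX : IsEngsetProcess ν (1 - ν) N C P X)
    (h0 : ∀ᵐ ω ∂P, X 0 ω = Fin.last C) (t : ℝ≥0) :
    Real.exp (-(t / engsetMeanHitting ν N C 1)) ≤
        P.real {ω | (t : ℝ≥0∞) < hittingTimeOf X 0 ω} ∧
      P.real {ω | (t : ℝ≥0∞) < hittingTimeOf X 0 ω} ≤
        engsetMeanHitting ν N C C / engsetMeanHitting ν N C 1 *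
          Real.exp (-(t / engsetMeanHitting ν N C C)) := by
  have ha := engsetMeanHitting_one_pos hν0 hν1 hC1 hC
  have hmono := engsetMeanHitting_mono (N := N) (C := C) hν0 hν1
  have hb := ha.trans_le (hmono hC1)
  obtain ⟨h1, h2⟩ := IsMarkovChainWithQMatrix.hittingTimeOf_tail_bounds hX (z := 0)
    (x₀ := Fin.last C) (fun h => by have := congrArg Fin.val h; simp at this; omega) h0
    (v := fun y => engsetMeanHitting ν N C y) (b := engsetMeanHitting ν N C C) ha
    (by simp [engsetMeanHitting])
    (fun x hx => hmono (Nat.one_le_iff_ne_zero.2 fun h => hx (Fin.ext h)))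
    (fun x _ => hmono (Nat.lt_succ_iff.1 x.2))
    (fun x hx => sum_engsetQMatrix_mul_meanHitting hν0 hν1 hC x hx) t
  simp only [Fin.val_last] at h1 h2
  -- The chain starts at `C`, where `v` equals its upper bound, so this factor cancels from the
  -- lower estimate.
  rw [mul_comm] at h1
  refine ⟨le_of_mul_le_mul_left h1 hb, ?_⟩
  rw [div_mul_eq_mul_div, le_div_iff₀ ha]
  linarith

theorem IsEngsetProcess.ae_hittingTimeOf_lt_top {Ω : Type*} [MeasurableSpace Ω] {P : Measure Ω}
    [IsProbabilityMeasure P] {X : ℝ≥0 → Ω → Fin (C + 1)} (hν0 : 0 < ν) (hν1 : ν < 1)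
    (hC : C ≤ N) (hX : IsEngsetProcess ν (1 - ν) N C P X)
    (h0 : ∀ᵐ ω ∂P, X 0 ω = Fin.last C) : ∀ᵐ ω ∂P, hittingTimeOf X 0 ω < ∞ := by
  rcases Nat.eq_zero_or_pos C with rfl | hC1
  · filter_upwards [hX.right_continuous] with ω hω
    refine lt_of_le_of_lt ((hittingTimeOf_le_iff (z := 0) hω 0).2 ⟨0, le_rfl, ?_⟩) (by simp)
    exact Fin.ext (by have := (X 0 ω).2; simp only [Fin.val_zero]; omega)
  have ha := engsetMeanHitting_one_pos hν0 hν1 hC1 hC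
  have hb := ha.trans_le (engsetMeanHitting_mono (N := N) (C := C) hν0 hν1 hC1)
  have h1 : P.real {ω | ¬ hittingTimeOf X 0 ω < ∞} = 0 := by
    refine le_antisymm ?_ measureReal_nonneg
    have hlim : Tendsto (fun n : ℕ => engsetMeanHitting ν N C C / engsetMeanHitting ν N C 1 *
        Real.exp (-((((n : ℕ) : ℝ≥0) : ℝ) / engsetMeanHitting ν N C C))) atTop
        (𝓝 (engsetMeanHitting ν N C C / engsetMeanHitting ν N C 1 * 0)) := by
      refine Tendsto.const_mul _ (Real.tendsto_exp_neg_atTop_nhds_zero.comp ?_)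
      simp_rw [NNReal.coe_natCast]
      exact tendsto_natCast_atTop_atTop.atTop_div_const hb
    rw [mul_zero] at hlim
    refine ge_of_tendsto' hlim fun n => ?_
    refine le_trans (measureReal_mono fun ω hω => ?_)
      (hX.hittingTimeOf_tail_bounds hν0 hν1 hC1 hC h0 n).2
    have : hittingTimeOf X 0 ω = ∞ := not_lt_top_iff.1 hω
    show _ < hittingTimeOf X 0 ω
    rw [this]
    exact ENNReal.coe_lt_top
  exact (measureReal_eq_zero_iff (measure_ne_top _ _)).1 h1

end Engset

/-! ### The step from `1` to `0` dominates the mean hitting time. -/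

section EngsetAsymptotics

variable {ν : ℝ} {N C : ℕ}

theorem binomialWeight_le_succ (hν0 : 0 < ν) (hν1 : ν < 1) {y : ℕ} (hy : (y : ℝ) + 1 ≤ ν * N) :
    binomialWeight ν N y ≤ binomialWeight ν N (y + 1) := by
  have hμ : 0 < 1 - ν := by linarith
  have hyN : y < N := by
    have : (y : ℝ) < N := by nlinarith [(Nat.cast_nonneg N : (0 : ℝ) ≤ N)]
    exact_mod_cast this
  have h1 := binomialWeight_succ (ν := ν) hyN
  have h2 : (0 : ℝ) < (1 - ν) * ((y + 1 : ℕ) : ℝ) := by positivity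
  refine le_of_mul_le_mul_right ?_ h2
  rw [h1]
  refine mul_le_mul_of_nonneg_left ?_ (binomialWeight_nonneg hν0 hν1 y)
  push_cast
  nlinarith

theorem binomialWeight_succ_le (hν0 : 0 < ν) (hν1 : ν < 1) {y : ℕ} (hyN : y < N)
    (hy : ν * N ≤ y) : binomialWeight ν N (y + 1) ≤ binomialWeight ν N y := by
  have hμ : 0 < 1 - ν := by linarith
  have h1 := binomialWeight_succ (ν := ν) hyN
  have h2 : (0 : ℝ) < (1 - ν) * ((y + 1 : ℕ) : ℝ) := by positivity
  refine le_of_mul_le_mul_right ?_ h2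
  rw [h1]
  refine mul_le_mul_of_nonneg_left ?_ (binomialWeight_nonneg hν0 hν1 y)
  push_cast
  nlinarith

theorem binomialWeight_le_of_le_mode (hν0 : 0 < ν) (hν1 : ν < 1) {x y : ℕ} (hxy : x ≤ y)
    (hy : (y : ℝ) ≤ ν * N) : binomialWeight ν N x ≤ binomialWeight ν N y := by
  induction y, hxy using Nat.le_induction with
  | base => exact le_rfl
  | succ y hxy ih =>
    push_cast at hy
    exact (ih (by linarith)).trans (binomialWeight_le_succ hν0 hν1 hy)

theorem binomialWeight_le_of_mode_le (hν0 : 0 < ν) (hν1 : ν < 1) {x y : ℕ} (hxy : x ≤ y)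
    (hyN : y ≤ N) (hx : ν * N ≤ x) : binomialWeight ν N y ≤ binomialWeight ν N x := by
  induction y, hxy using Nat.le_induction with
  | base => exact le_rfl
  | succ y hxy ih =>
    refine (binomialWeight_succ_le hν0 hν1 (by omega) (hx.trans ?_)).trans (ih (by omega))
    exact_mod_cast hxy

/-- Here `48 = 3! * 2 ^ 3`, and `4 ≤ N` ensures `N / 2 ≤ N + 1 - r`. -/
theorem le_binomialWeight (hν0 : 0 < ν) (hν1 : ν < 1) (hN : 4 ≤ N) {r : ℕ} (hr : r ≤ 3) :
    (N : ℝ) ^ r * (ν ^ 3 * (1 - ν) ^ N) / 48 ≤ binomialWeight ν N r := by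
  have hμ : 0 < 1 - ν := by linarith
  have h1 : ((N + 1 - r : ℕ) : ℝ) ^ r ≤ r.factorial * N.choose r := by
    have h := Nat.pow_le_choose (α := ℝ) r N
    rw [div_le_iff₀ (by positivity), mul_comm] at h
    exact_mod_cast h
  have h2 : (N : ℝ) / 2 ≤ ((N + 1 - r : ℕ) : ℝ) := by
    rw [div_le_iff₀ two_pos]
    exact_mod_cast (show N ≤ (N + 1 - r) * 2 by omega)
  have h3 : ((N : ℝ) / 2) ^ r ≤ r.factorial * N.choose r :=
    (pow_le_pow_left₀ (by positivity) h2 r).trans h1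
  have h4 : (N : ℝ) ^ r / 48 ≤ N.choose r := by
    rw [div_pow, div_le_iff₀ (by positivity)] at h3
    have h5 : (r.factorial : ℝ) * 2 ^ r ≤ 48 := by
      interval_cases r <;> norm_num [Nat.factorial]
    rw [div_le_iff₀ (by norm_num)]
    nlinarith [(Nat.cast_nonneg (N.choose r) : (0 : ℝ) ≤ N.choose r)]
  have h5 : ν ^ 3 ≤ ν ^ r := pow_le_pow_of_le_one hν0.le hν1.le hr
  have h6 : (1 - ν) ^ N ≤ (1 - ν) ^ (N - r) :=
    pow_le_pow_of_le_one hμ.le (by linarith) (Nat.sub_le _ _)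
  unfold binomialWeight
  calc (N : ℝ) ^ r * (ν ^ 3 * (1 - ν) ^ N) / 48 = (N : ℝ) ^ r / 48 * ν ^ 3 * (1 - ν) ^ N := by ring
    _ ≤ _ := by gcongr

theorem engsetStepMean_le_inv (hν0 : 0 < ν) (hν1 : ν < 1) (hC : C ≤ N) {x : ℕ} (hx1 : 1 ≤ x)
    (hxN : x ≤ N) : engsetStepMean ν N C x ≤ 1 / (binomialWeight ν N x * (1 - ν)) := by
  have hμ : 0 < 1 - ν := by linarith
  have hw := binomialWeight_pos hν0 hν1 hxN
  have hx : (1 : ℝ) ≤ x := by exact_mod_cast hx1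
  unfold engsetStepMean
  exact div_le_div₀ zero_le_one (sum_binomialWeight_le_one hν0 hν1 hC x) (by positivity)
    (mul_le_mul_of_nonneg_left (le_mul_of_one_le_right hμ.le hx) hw.le)

theorem engsetStepMean_le_of_mode_le (hν0 : 0 < ν) (hν1 : ν < 1) (hC : C ≤ N) {x : ℕ}
    (hx1 : 1 ≤ x) (hxN : x ≤ N) (hx : ν * N ≤ x) : engsetStepMean ν N C x ≤ N / (1 - ν) := by
  have hμ : 0 < 1 - ν := by linarith
  have hw := binomialWeight_pos hν0 hν1 hxN
  have hx' : (1 : ℝ) ≤ x := by exact_mod_cast hx1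
  have h1 : ∑ y ∈ Finset.Icc x C, binomialWeight ν N y ≤ N * binomialWeight ν N x := by
    calc _ ≤ ∑ y ∈ Finset.Icc x C, binomialWeight ν N x :=
          Finset.sum_le_sum fun y hy => binomialWeight_le_of_mode_le hν0 hν1
            (Finset.mem_Icc.1 hy).1 ((Finset.mem_Icc.1 hy).2.trans hC) hx
      _ = ((C + 1 - x : ℕ) : ℝ) * binomialWeight ν N x := by
          rw [Finset.sum_const, Nat.card_Icc, nsmul_eq_mul]
      _ ≤ _ := by
          refine mul_le_mul_of_nonneg_right ?_ hw.le
          exact_mod_cast (show C + 1 - x ≤ N by omega)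
  unfold engsetStepMean
  calc _ ≤ N * binomialWeight ν N x / (binomialWeight ν N x * (1 - ν)) :=
        div_le_div₀ (by positivity) h1 (by positivity)
          (mul_le_mul_of_nonneg_left (le_mul_of_one_le_right hμ.le hx') hw.le)
    _ = _ := by field_simp

/-- The weights are unimodal: beyond the mode the tail sum is at most `N` times its first term, and
before it the weight at `x` is at least that at `3`. -/
theorem engsetStepMean_le (hν0 : 0 < ν) (hν1 : ν < 1) (hC : C ≤ N) {x : ℕ} (hx3 : 3 ≤ x)
    (hxN : x ≤ N) :
    engsetStepMean ν N C x ≤ N / (1 - ν) + 1 / (binomialWeight ν N 3 * (1 - ν)) := by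
  have hμ : 0 < 1 - ν := by linarith
  have hw := binomialWeight_pos hν0 hν1 (show 3 ≤ N by omega)
  rcases le_total (ν * N) x with h | h
  · have := engsetStepMean_le_of_mode_le hν0 hν1 hC (by omega) hxN h
    have : 0 ≤ 1 / (binomialWeight ν N 3 * (1 - ν)) := by positivity
    linarith
  · have h1 := engsetStepMean_le_inv hν0 hν1 hC (show 1 ≤ x by omega) hxN
    have h2 : 1 / (binomialWeight ν N x * (1 - ν)) ≤ 1 / (binomialWeight ν N 3 * (1 - ν)) := by
      have := binomialWeight_le_of_le_mode hν0 hν1 hx3 h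
      gcongr
    have : 0 ≤ (N : ℝ) / (1 - ν) := by positivity
    linarith

/-- State `2` is treated apart because there are up to `N` further steps: bounding each by the
weight at `2`, of order `N ^ 2 (1 - ν)^N`, would only match the main term, whereas the weight at `3`
gains a factor `N`. -/
theorem engsetMeanHitting_le (hν0 : 0 < ν) (hν1 : ν < 1) (hC : C ≤ N) (hN : 4 ≤ N) :
    engsetMeanHitting ν N C C ≤ engsetMeanHitting ν N C 1 +
      (1 / (binomialWeight ν N 2 * (1 - ν)) +
        N * (N / (1 - ν) + 1 / (binomialWeight ν N 3 * (1 - ν)))) := by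
  have hμ : 0 < 1 - ν := by linarith
  have hw3 := binomialWeight_pos hν0 hν1 (show 3 ≤ N by omega)
  have hw2 := binomialWeight_pos hν0 hν1 (show 2 ≤ N by omega)
  have hsub : Finset.Icc 1 C ⊆ Finset.Icc 1 1 ∪ ({2} ∪ Finset.Icc 3 N) := by
    intro x hx
    simp only [Finset.mem_union, Finset.mem_Icc, Finset.mem_singleton] at hx ⊢
    omega
  have hnn := fun x => engsetStepMean_nonneg (N := N) (C := C) hν0 hν1 x
  have h1 : engsetMeanHitting ν N C C ≤ engsetMeanHitting ν N C 1 +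
      (engsetStepMean ν N C 2 + ∑ x ∈ Finset.Icc 3 N, engsetStepMean ν N C x) := by
    unfold engsetMeanHitting
    refine (Finset.sum_le_sum_of_subset_of_nonneg hsub fun x _ _ => hnn x).trans ?_
    have hd1 : Disjoint ({2} : Finset ℕ) (Finset.Icc 3 N) := by
      simp
    have hd2 : Disjoint (Finset.Icc 1 1) ({2} ∪ Finset.Icc 3 N) := by
      rw [Finset.Icc_self]; simp
    rw [Finset.sum_union hd2, Finset.sum_union hd1, Finset.sum_singleton]
  have h2 := engsetStepMean_le_inv hν0 hν1 hC one_le_two (show 2 ≤ N by omega)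
  have h3 : ∑ x ∈ Finset.Icc 3 N, engsetStepMean ν N C x ≤
      N * (N / (1 - ν) + 1 / (binomialWeight ν N 3 * (1 - ν))) := by
    calc _ ≤ ∑ x ∈ Finset.Icc 3 N, (N / (1 - ν) + 1 / (binomialWeight ν N 3 * (1 - ν))) :=
          Finset.sum_le_sum fun x hx => engsetStepMean_le hν0 hν1 hC
            (Finset.mem_Icc.1 hx).1 (Finset.mem_Icc.1 hx).2
      _ = ((N + 1 - 3 : ℕ) : ℝ) * (N / (1 - ν) + 1 / (binomialWeight ν N 3 * (1 - ν))) := by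
          rw [Finset.sum_const, Nat.card_Icc, nsmul_eq_mul]
      _ ≤ _ := by
          refine mul_le_mul_of_nonneg_right ?_ (by positivity)
          exact_mod_cast (show N + 1 - 3 ≤ N by omega)
  linarith

theorem mul_engsetMeanHitting_le (hν0 : 0 < ν) (hν1 : ν < 1) (hC : C ≤ N) (hN : 4 ≤ N) :
    N * (1 - ν) ^ N * engsetMeanHitting ν N C C ≤
      N * (1 - ν) ^ N * engsetMeanHitting ν N C 1 +
        (96 / (ν ^ 3 * (1 - ν)) * (N : ℝ)⁻¹ + (1 - ν)⁻¹ * ((N : ℝ) ^ 3 * (1 - ν) ^ N)) := by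
  have hμ : 0 < 1 - ν := by linarith
  have hN0 : (0 : ℝ) < N := by exact_mod_cast (show 0 < N by omega)
  have hinv : ∀ r : ℕ, r ≤ 3 → 1 / (binomialWeight ν N r * (1 - ν)) ≤
      1 / ((N : ℝ) ^ r * (ν ^ 3 * (1 - ν) ^ N) / 48 * (1 - ν)) := fun r hr => by
    have := le_binomialWeight hν0 hν1 hN hr
    gcongr
  have h1 := engsetMeanHitting_le hν0 hν1 hC hN
  have h2 : engsetMeanHitting ν N C C ≤ engsetMeanHitting ν N C 1 +
      (1 / ((N : ℝ) ^ 2 * (ν ^ 3 * (1 - ν) ^ N) / 48 * (1 - ν)) +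
        N * (N / (1 - ν) + 1 / ((N : ℝ) ^ 3 * (ν ^ 3 * (1 - ν) ^ N) / 48 * (1 - ν)))) := by
    refine h1.trans ?_
    have := hinv 2 (by norm_num)
    have := hinv 3 (by norm_num)
    gcongr
  have h3 : (0 : ℝ) ≤ N * (1 - ν) ^ N := by positivity
  refine (mul_le_mul_of_nonneg_left h2 h3).trans (le_of_eq ?_)
  field_simp
  ring

theorem mul_engsetMeanHitting_one (hν0 : 0 < ν) (hν1 : ν < 1) (hN : 1 ≤ N) :
    N * (1 - ν) ^ N * engsetMeanHitting ν N C 1 =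
      (∑ y ∈ Finset.Icc 1 C, binomialWeight ν N y) / ν := by
  have hμ : 0 < 1 - ν := by linarith
  have hN0 : (0 : ℝ) < N := by exact_mod_cast (show 0 < N by omega)
  unfold engsetMeanHitting engsetStepMean
  rw [Finset.Icc_self, Finset.sum_singleton]
  set s := ∑ y ∈ Finset.Icc 1 C, binomialWeight ν N y
  have h1 : (1 - ν) ^ N = (1 - ν) ^ (N - 1) * (1 - ν) := by
    rw [← pow_succ, Nat.sub_add_cancel hN]
  unfold binomialWeight
  rw [h1, Nat.choose_one_right]
  field_simp
  simp

theorem tendsto_mul_engsetMeanHitting_one (hν0 : 0 < ν) (hν1 : ν < 1) {C : ℕ → ℕ} {c : ℝ}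
    (hlim : Tendsto (fun N => ∑ y ∈ Finset.Icc 1 (C N), binomialWeight ν N y) atTop (𝓝 c)) :
    Tendsto (fun N : ℕ => N * (1 - ν) ^ N * engsetMeanHitting ν N (C N) 1) atTop (𝓝 (c / ν)) := by
  refine (hlim.div_const ν).congr' ?_
  filter_upwards [eventually_ge_atTop 1] with N hN
  rw [mul_engsetMeanHitting_one hν0 hν1 hN]

theorem tendsto_mul_engsetMeanHitting (hν0 : 0 < ν) (hν1 : ν < 1) {C : ℕ → ℕ}
    (hC : ∀ N, C N ≤ N) (hC1 : ∀ᶠ N in atTop, 1 ≤ C N) {c : ℝ}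
    (hlim : Tendsto (fun N => ∑ y ∈ Finset.Icc 1 (C N), binomialWeight ν N y) atTop (𝓝 c)) :
    Tendsto (fun N : ℕ => N * (1 - ν) ^ N * engsetMeanHitting ν N (C N) (C N)) atTop
      (𝓝 (c / ν)) := by
  have hμ : 0 < 1 - ν := by linarith
  have h1 := tendsto_mul_engsetMeanHitting_one hν0 hν1 hlim
  have h2 : Tendsto (fun N : ℕ => N * (1 - ν) ^ N * engsetMeanHitting ν N (C N) 1 +
      (96 / (ν ^ 3 * (1 - ν)) * (N : ℝ)⁻¹ + (1 - ν)⁻¹ * ((N : ℝ) ^ 3 * (1 - ν) ^ N))) atTop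
      (𝓝 (c / ν + (96 / (ν ^ 3 * (1 - ν)) * 0 + (1 - ν)⁻¹ * 0))) :=
    h1.add ((tendsto_inv_atTop_nhds_zero_nat.const_mul _).add
      ((tendsto_pow_const_mul_const_pow_of_abs_lt_one 3
        (by rw [abs_of_pos hμ]; linarith)).const_mul _))
  rw [mul_zero, mul_zero, add_zero, add_zero] at h2
  refine tendsto_of_tendsto_of_tendsto_of_le_of_le' h1 h2 ?_ ?_
  · filter_upwards [hC1] with N hN
    exact mul_le_mul_of_nonneg_left (engsetMeanHitting_mono hν0 hν1 hN) (by positivity)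
  · filter_upwards [eventually_ge_atTop 4] with N h4
    exact mul_engsetMeanHitting_le hν0 hν1 (hC N) h4

end EngsetAsymptotics

/-! ### Limits of binomial distribution functions. -/

section BinomialLimits

variable {ν : ℝ}

theorem gaussianReal_real_Iic_zero : (gaussianReal 0 1).real (Set.Iic 0) = 1 / 2 := by
  have hNA : NullSingletonClass (gaussianReal 0 1) := nullSingletonClass_gaussianReal one_ne_zero
  have h1 : (gaussianReal 0 1).real (Set.Ioi 0) = (gaussianReal 0 1).real (Set.Iic 0) := by
    have h2 : (gaussianReal 0 1).map (fun x => -x) = gaussianReal 0 1 := by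
      rw [gaussianReal_map_neg, neg_zero]
    conv_lhs => rw [← h2]
    rw [map_measureReal_apply measurable_neg measurableSet_Ioi]
    have h3 : (fun x : ℝ => -x) ⁻¹' Set.Ioi 0 = Set.Iio 0 := by ext; simp
    rw [h3]
    exact measureReal_congr Iio_ae_eq_Iic
  have h4 := probReal_add_probReal_compl (μ := gaussianReal 0 1) (measurableSet_Iic (a := (0 : ℝ)))
  rw [Set.compl_Iic, h1] at h4
  linarith

/-- The binomial theorem turns the sum into a power. Centring at `c` instead of the mean costs only
a phase. -/
theorem charFun_map_binomial (p : unitInterval) (N : ℕ) (c s t : ℝ) :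
    charFun ((binomial N p).map (fun k : ℕ => (√N)⁻¹ * ((k - c) / s))) t =
      charFun ((bernoulliMeasure (1 : ℝ) 0 p).map (fun x => (x - p) / s)) ((√N)⁻¹ * t) ^ N *
        Complex.exp (t * ((√N)⁻¹ * ((N * p - c) / s)) * Complex.I) := by
  rw [charFun_apply_real, charFun_apply_real,
    integral_map Measurable.of_discrete.aemeasurable (by fun_prop),
    integral_map (by fun_prop) (by fun_prop), integral_binomial, integral_bernoulliMeasure,
    add_pow, Finset.sum_mul, Nat.range_succ_eq_Iic]
  refine Finset.sum_congr rfl fun k hk => ?_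
  have hk : k ≤ N := Finset.mem_Iic.1 hk
  simp only [Complex.real_smul]
  push_cast
  rw [mul_pow, mul_pow, ← Complex.exp_nat_mul, ← Complex.exp_nat_mul]
  have h1 : Complex.exp (t * ((√N : ℂ)⁻¹ * ((k - c) / s)) * Complex.I) =
      Complex.exp (k * ((√N : ℂ)⁻¹ * t * ((1 - p) / s) * Complex.I)) *
      Complex.exp ((N - k : ℕ) * ((√N : ℂ)⁻¹ * t * ((0 - p) / s) * Complex.I)) *
      Complex.exp (t * ((√N : ℂ)⁻¹ * ((N * p - c) / s)) * Complex.I) := by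
    rw [← Complex.exp_add, ← Complex.exp_add]
    congr 1
    rw [Nat.cast_sub hk]
    ring
  rw [h1]
  ring

/-- De Moivre-Laplace theorem, at a point close to the mean. -/
theorem tendsto_binomial_real_Iic (hν0 : 0 < ν) (hν1 : ν < 1) {C : ℕ → ℕ}
    (h : (fun N : ℕ => (C N : ℝ) - ν * N) =o[atTop] (fun N : ℕ => √(N : ℝ))) :
    Tendsto (fun N : ℕ => (binomial N ⟨ν, hν0.le, hν1.le⟩).real (Set.Iic (C N))) atTop
      (𝓝 (1 / 2)) := by
  set p : unitInterval := ⟨ν, hν0.le, hν1.le⟩ with hp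
  have hpν : (p : ℝ) = ν := rfl
  set s : ℝ := √(ν * (1 - ν)) with hs
  have hs2 : s ^ 2 = ν * (1 - ν) := Real.sq_sqrt (mul_nonneg hν0.le (by linarith))
  have hs0 : 0 < s := Real.sqrt_pos.2 (mul_pos hν0 (by linarith))
  have hprob : ∀ N : ℕ, IsProbabilityMeasure
      ((binomial N p).map (fun k : ℕ => (√N)⁻¹ * ((k - (C N : ℝ)) / s))) := fun N =>
    Measure.isProbabilityMeasure_map Measurable.of_discrete.aemeasurable
  let μs : ℕ → ProbabilityMeasure ℝ := fun N => ⟨_, hprob N⟩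
  let μ : ProbabilityMeasure ℝ := ⟨gaussianReal 0 1, inferInstance⟩
  have hlim : Tendsto μs atTop (𝓝 μ) := by
    refine ProbabilityMeasure.tendsto_iff_tendsto_charFun.2 fun t => ?_
    have h1 := tendsto_charFun_inv_sqrt_mul_pow (P := bernoulliMeasure (1 : ℝ) 0 p)
      (X := fun x => (x - p) / s) (by fun_prop)
      (by rw [integral_bernoulliMeasure, smul_eq_mul, smul_eq_mul]; ring)
      (by
        simp only [Pi.pow_apply]
        rw [integral_bernoulliMeasure, smul_eq_mul, smul_eq_mul, div_pow, div_pow, hs2, hpν]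
        have : 1 - ν ≠ 0 := by linarith
        field_simp
        ring) t
    -- The only use of `C N = ν N + o(√N)`: the phase disappears in the limit.
    have h2 : Tendsto (fun N : ℕ => (√(N : ℝ))⁻¹ * ((N * p - C N) / s)) atTop (𝓝 0) := by
      have h3 := h.tendsto_div_nhds_zero.div_const (-s)
      rw [zero_div] at h3
      refine h3.congr fun N => ?_
      rw [hpν]
      field_simp
      ring
    have h4 : Tendsto (fun N : ℕ => Complex.exp
        (t * (((√(N : ℝ))⁻¹ * ((N * p - C N) / s) : ℝ) : ℂ) * Complex.I)) atTop (𝓝 1) := by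
      have h5 : Tendsto (fun N : ℕ =>
          t * (((√(N : ℝ))⁻¹ * ((N * p - C N) / s) : ℝ) : ℂ) * Complex.I) atTop
          (𝓝 (t * ((0 : ℝ) : ℂ) * Complex.I)) :=
        (((Complex.continuous_ofReal.tendsto 0).comp h2).const_mul _).mul_const _
      have h6 := (Complex.continuous_exp.tendsto _).comp h5
      simpa [Function.comp_def] using h6
    have h7 := h1.mul h4
    rw [mul_one] at h7
    have h8 : charFun (μ : Measure ℝ) t = Complex.exp (-(t : ℂ) ^ 2 / 2) := by
      show charFun (gaussianReal 0 1) t = _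
      rw [charFun_gaussianReal]
      simp [neg_div]
    rw [h8]
    refine h7.congr fun N => ?_
    show _ = charFun ((binomial N p).map (fun k : ℕ => (√N)⁻¹ * ((k - (C N : ℝ)) / s))) t
    rw [charFun_map_binomial]
    push_cast
    rfl
  have hNA : NullSingletonClass (gaussianReal 0 1) := nullSingletonClass_gaussianReal one_ne_zero
  have hlim' := ProbabilityMeasure.tendsto_measure_of_null_frontier_of_tendsto' hlim
    (E := Set.Iic 0) (by
      rw [frontier_Iic]
      exact hNA.measure_singleton 0)
  have h9 := (ENNReal.tendsto_toReal (measure_ne_top (μ : Measure ℝ) (Set.Iic 0))).comp hlim'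
  rw [← gaussianReal_real_Iic_zero]
  refine h9.congr' ?_
  filter_upwards [eventually_gt_atTop 0] with N hN
  show ((binomial N p).map (fun k : ℕ => (√N)⁻¹ * ((k - (C N : ℝ)) / s))).real (Set.Iic 0) = _
  rw [map_measureReal_apply Measurable.of_discrete measurableSet_Iic]
  congr 1
  ext k
  have hN' : (0 : ℝ) < √N := Real.sqrt_pos.2 (by exact_mod_cast hN)
  rw [Set.mem_preimage, Set.mem_Iic, Set.mem_Iic, ← div_eq_inv_mul, div_le_iff₀ hN', zero_mul,
    div_le_iff₀ hs0, zero_mul, sub_nonpos, Nat.cast_le]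

theorem binomial_real_Iic_eq_sum (hν0 : 0 < ν) (hν1 : ν < 1) (N c : ℕ) :
    (binomial N ⟨ν, hν0.le, hν1.le⟩).real (Set.Iic c) =
      ∑ k ∈ Finset.range (c + 1), binomialWeight ν N k := by
  have h := sum_measureReal_singleton (μ := binomial N ⟨ν, hν0.le, hν1.le⟩) (Finset.range (c + 1))
  rw [Nat.range_succ_eq_Iic, Finset.coe_Iic] at h
  rw [← h, Nat.range_succ_eq_Iic]
  exact Finset.sum_congr rfl fun k _ => binomial_real_singleton N k _

theorem sum_sq_mul_binomialWeight (ν : ℝ) (N : ℕ) :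
    ∑ k ∈ Finset.range (N + 1), (N * ν - k) ^ 2 * binomialWeight ν N k = N * ν * (1 - ν) := by
  have h := congrArg (Polynomial.eval ν) (bernsteinPolynomial.variance ℝ N)
  simp only [Polynomial.eval_finsetSum, bernsteinPolynomial] at h
  simpa [binomialWeight] using h

/-- Chebyshev's inequality: for large `N`, `C N` exceeds the mean by at least `δ N`, half of the gap
`(η - ν) N`; the other half absorbs the bounded error. -/
theorem tendsto_sum_binomialWeight_of_lt (hν0 : 0 < ν) (hν1 : ν < 1) {C : ℕ → ℕ}
    (hC : ∀ N, C N ≤ N) {η : ℝ} (hη : ν < η)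
    (h : (fun N : ℕ => (C N : ℝ) - η * N) =O[atTop] (fun _ : ℕ => (1 : ℝ))) :
    Tendsto (fun N : ℕ => ∑ k ∈ Finset.range (C N + 1), binomialWeight ν N k) atTop (𝓝 1) := by
  have hμ : 0 < 1 - ν := by linarith
  obtain ⟨K, hK⟩ := h.bound
  set δ := (η - ν) / 2 with hδ
  have hδ0 : 0 < δ := by rw [hδ]; linarith
  have hlow : Tendsto (fun N : ℕ => 1 - ν * (1 - ν) / δ ^ 2 * (N : ℝ)⁻¹) atTop
      (𝓝 (1 - ν * (1 - ν) / δ ^ 2 * 0)) :=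
    tendsto_const_nhds.sub (tendsto_inv_atTop_nhds_zero_nat.const_mul _)
  rw [mul_zero, sub_zero] at hlow
  refine tendsto_of_tendsto_of_tendsto_of_le_of_le' hlow tendsto_const_nhds ?_ ?_
  · filter_upwards [hK, eventually_gt_atTop 0,
      (tendsto_natCast_atTop_atTop (R := ℝ)).eventually_ge_atTop (K / δ)] with N h1 h2 h3
    rw [norm_one, mul_one, Real.norm_eq_abs] at h1
    have h4 := neg_le_of_abs_le h1
    have hN0 : (0 : ℝ) < N := by exact_mod_cast h2
    rw [div_le_iff₀ hδ0] at h3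
    have h5 : δ * N ≤ C N - N * ν := by
      have : η = ν + 2 * δ := by rw [hδ]; ring
      rw [this] at h4
      nlinarith
    have hsplit := Finset.sum_range_add_sum_Ico (binomialWeight ν N)
      (show C N + 1 ≤ N + 1 by have := hC N; omega)
    rw [sum_binomialWeight] at hsplit
    have h6 : (δ * N) ^ 2 * ∑ k ∈ Finset.Ico (C N + 1) (N + 1), binomialWeight ν N k ≤
        N * ν * (1 - ν) := by
      rw [← sum_sq_mul_binomialWeight ν N, Finset.mul_sum]
      refine le_trans (Finset.sum_le_sum fun k hk => ?_) (Finset.sum_le_sum_of_subset_of_nonneg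
        (fun k hk => Finset.mem_range.2 (Finset.mem_Ico.1 hk).2) fun k _ _ =>
          mul_nonneg (sq_nonneg _) (binomialWeight_nonneg hν0 hν1 k))
      refine mul_le_mul_of_nonneg_right ?_ (binomialWeight_nonneg hν0 hν1 k)
      have : ((C N : ℕ) : ℝ) ≤ k := by
        have := (Finset.mem_Ico.1 hk).1
        exact_mod_cast (show C N ≤ k by omega)
      rw [← neg_sq (N * ν - (k : ℝ))]
      exact pow_le_pow_left₀ (by positivity) (by linarith) 2
    have h7 : ∑ k ∈ Finset.Ico (C N + 1) (N + 1), binomialWeight ν N k ≤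
        ν * (1 - ν) / δ ^ 2 * (N : ℝ)⁻¹ := by
      rw [mul_comm, ← le_div_iff₀ (by positivity)] at h6
      refine h6.trans (le_of_eq ?_)
      field_simp
    linarith
  · refine Eventually.of_forall fun N => ?_
    rw [← sum_binomialWeight ν N]
    exact Finset.sum_le_sum_of_subset_of_nonneg
      (Finset.range_subset_range.2 (by have := hC N; omega))
      fun k _ _ => binomialWeight_nonneg hν0 hν1 k

theorem tendsto_sum_Icc_binomialWeight (hν0 : 0 < ν) (hν1 : ν < 1) {C : ℕ → ℕ} {c : ℝ}
    (h : Tendsto (fun N : ℕ => ∑ k ∈ Finset.range (C N + 1), binomialWeight ν N k) atTop (𝓝 c)) :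
    Tendsto (fun N : ℕ => ∑ k ∈ Finset.Icc 1 (C N), binomialWeight ν N k) atTop (𝓝 c) := by
  have h1 : Tendsto (fun N : ℕ => (1 - ν) ^ N) atTop (𝓝 0) :=
    tendsto_pow_atTop_nhds_zero_of_lt_one (by linarith) (by linarith)
  have h2 := h.sub h1
  rw [sub_zero] at h2
  refine h2.congr fun N => ?_
  rw [Finset.range_eq_Ico, Finset.sum_eq_sum_Ico_succ_bot (by omega)]
  have : binomialWeight ν N 0 = (1 - ν) ^ N := by simp [binomialWeight]
  rw [this, add_sub_cancel_left]
  rfl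

theorem eventually_one_le_of_tendsto_sum {C : ℕ → ℕ} {c : ℝ}
    (hc : 0 < c)
    (h : Tendsto (fun N : ℕ => ∑ k ∈ Finset.Icc 1 (C N), binomialWeight ν N k) atTop (𝓝 c)) :
    ∀ᶠ N in atTop, 1 ≤ C N := by
  filter_upwards [h.eventually (lt_mem_nhds hc)] with N hN
  by_contra hlt
  rw [Finset.Icc_eq_empty hlt, Finset.sum_empty] at hN
  exact lt_irrefl _ hN

end BinomialLimits

/-! ### Convergence in distribution from convergence of tails. -/

section ConvergenceInDistribution

/-- Differences of tails give the half-open intervals, a π-system containing arbitrarily small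
neighbourhoods of each point. -/
theorem tendsto_probabilityMeasure_of_tendsto_Ioi {ι : Type*} {l : Filter ι}
    [l.IsCountablyGenerated] {μs : ι → ProbabilityMeasure ℝ} {μ : ProbabilityMeasure ℝ}
    (h : ∀ s : ℝ, Tendsto (fun i => (μs i : Measure ℝ).real (Set.Ioi s)) l
      (𝓝 ((μ : Measure ℝ).real (Set.Ioi s)))) :
    Tendsto μs l (𝓝 μ) := by
  refine IsPiSystem.tendsto_probabilityMeasure_of_tendsto_of_mem
    (isPiSystem_Ioc (f := (id : ℝ → ℝ)) (g := (id : ℝ → ℝ))) ?_ ?_ ?_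
  · rintro _ ⟨a, b, -, rfl⟩
    exact measurableSet_Ioc
  · intro u hu x hx
    obtain ⟨ε, hε, hsub⟩ := Metric.isOpen_iff.1 hu x hx
    refine ⟨Set.Ioc (x - ε / 2) (x + ε / 2), ⟨x - ε / 2, x + ε / 2, by simp; linarith, rfl⟩,
      Ioc_mem_nhds (by linarith) (by linarith), fun y hy => hsub ?_⟩
    rw [Metric.mem_ball, Real.dist_eq, abs_lt]
    constructor <;> linarith [hy.1, hy.2]
  · rintro _ ⟨a, b, hab, rfl⟩
    have hab' : a ≤ b := hab.le
    have key : ∀ κ : ProbabilityMeasure ℝ, ((κ (Set.Ioc a b) : ℝ≥0) : ℝ) =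
        (κ : Measure ℝ).real (Set.Ioi a) - (κ : Measure ℝ).real (Set.Ioi b) := by
      intro κ
      rw [← Set.Ioi_sdiff_Ioi,
        ← measureReal_sdiff (Set.Ioi_subset_Ioi hab') measurableSet_Ioi]
      rfl
    rw [← NNReal.tendsto_coe]
    simp only [id, key]
    exact (h a).sub (h b)

theorem expMeasure_real_Ioi {r : ℝ} (hr : 0 < r) (s : ℝ) :
    (expMeasure r).real (Set.Ioi s) = if 0 ≤ s then Real.exp (-(r * s)) else 1 := by
  have := isProbabilityMeasure_expMeasure hr
  have h1 := cdf_expMeasure_eq hr s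
  rw [cdf_eq_real] at h1
  have h2 := probReal_add_probReal_compl (μ := expMeasure r) (measurableSet_Iic (a := s))
  rw [Set.compl_Iic, h1] at h2
  split_ifs at h2 ⊢ <;> linarith

theorem tendstoInDistribution_exp_of_tendsto_tail {Ω : ℕ → Type*} [∀ N, MeasurableSpace (Ω N)]
    {P : ∀ N, Measure (Ω N)} [∀ N, IsProbabilityMeasure (P N)] {Y : ∀ N, Ω N → ℝ}
    (hY : ∀ N, AEMeasurable (Y N) (P N)) (hY0 : ∀ N ω, 0 ≤ Y N ω) {r : ℝ} (hr : 0 < r)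
    (h : ∀ s : ℝ, 0 ≤ s → Tendsto (fun N => (P N).real {ω | s < Y N ω}) atTop
      (𝓝 (Real.exp (-(r * s)))))
    {Ω' : Type*} [MeasurableSpace Ω'] (P' : Measure Ω') [IsProbabilityMeasure P'] {Z : Ω' → ℝ}
    (hZ : HasLaw Z (expMeasure r) P') : TendstoInDistribution Y atTop Z P P' where
  forall_aemeasurable := hY
  aemeasurable_limit := hZ.aemeasurable
  tendsto := by
    refine tendsto_probabilityMeasure_of_tendsto_Ioi fun s => ?_
    have h1 : ∀ N, ((P N).map (Y N)).real (Set.Ioi s) = (P N).real {ω | s < Y N ω} := fun N =>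
      map_measureReal_apply_of_aemeasurable (hY N) measurableSet_Ioi
    simp only [ProbabilityMeasure.coe_mk, h1, hZ.map_eq, expMeasure_real_Ioi hr]
    split_ifs with hs
    · exact h s hs
    · refine tendsto_const_nhds.congr fun N => ?_
      have : {ω | s < Y N ω} = Set.univ :=
        Set.eq_univ_of_forall fun ω => (not_le.1 hs).trans_le (hY0 N ω)
      rw [this, probReal_univ]

end ConvergenceInDistribution

/-! ### The limit law of the rescaled hitting time. -/

section EngsetLimit

variable {ν : ℝ} {C : ℕ → ℕ} {Ω : ℕ → Type*} [∀ N, MeasurableSpace (Ω N)]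
  {P : ∀ N, Measure (Ω N)} [∀ N, IsProbabilityMeasure (P N)]
  {X : ∀ N, ℝ≥0 → Ω N → Fin (C N + 1)}

theorem IsEngsetProcess.tendsto_tail (hν0 : 0 < ν) (hν1 : ν < 1) (hC : ∀ N, C N ≤ N)
    (hX : ∀ N, IsEngsetProcess ν (1 - ν) N (C N) (P N) (X N))
    (hX0 : ∀ N, ∀ᵐ ω ∂(P N), X N 0 ω = Fin.last (C N)) {c : ℝ} (hc : 0 < c)
    (hlim : Tendsto (fun N : ℕ => ∑ k ∈ Finset.range (C N + 1), binomialWeight ν N k) atTop (𝓝 c))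
    {s : ℝ} (hs : 0 ≤ s) :
    Tendsto (fun N : ℕ => (P N).real
      {ω | s < (N : ℝ) * (1 - ν) ^ N * (hittingTimeOf (X N) 0 ω).toReal}) atTop
      (𝓝 (Real.exp (-(ν / c * s)))) := by
  have hμ : 0 < 1 - ν := by linarith
  have hlim1 := tendsto_sum_Icc_binomialWeight hν0 hν1 hlim
  have hC1 := eventually_one_le_of_tendsto_sum hc hlim1
  have ha := tendsto_mul_engsetMeanHitting_one hν0 hν1 hlim1
  have hb := tendsto_mul_engsetMeanHitting hν0 hν1 hC hC1 hlim1
  have hcν : c / ν ≠ 0 := (div_pos hc hν0).ne'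
  set a : ℕ → ℝ := fun N => N * (1 - ν) ^ N * engsetMeanHitting ν N (C N) 1
  set b : ℕ → ℝ := fun N => N * (1 - ν) ^ N * engsetMeanHitting ν N (C N) (C N)
  have hexp : ∀ {u : ℕ → ℝ}, Tendsto u atTop (𝓝 (c / ν)) →
      Tendsto (fun N => Real.exp (-(s / u N))) atTop (𝓝 (Real.exp (-(ν / c * s)))) := by
    intro u hu
    have h1 := (Real.continuous_exp.tendsto _).comp ((tendsto_const_nhds (x := s)).div hu hcν).neg
    have h2 : s / (c / ν) = ν / c * s := by field_simp
    rw [h2] at h1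
    exact h1
  have hup : Tendsto (fun N => b N / a N * Real.exp (-(s / b N))) atTop
      (𝓝 (Real.exp (-(ν / c * s)))) := by
    have h1 := (hb.div ha hcν).mul (hexp hb)
    rwa [div_self hcν, one_mul] at h1
  have hbounds : ∀ᶠ N : ℕ in atTop, Real.exp (-(s / a N)) ≤ (P N).real
        {ω | s < (N : ℝ) * (1 - ν) ^ N * (hittingTimeOf (X N) 0 ω).toReal} ∧
      (P N).real {ω | s < (N : ℝ) * (1 - ν) ^ N * (hittingTimeOf (X N) 0 ω).toReal} ≤
        b N / a N * Real.exp (-(s / b N)) := by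
    filter_upwards [hC1, eventually_gt_atTop 0] with N hN hN0
    have hα : (0 : ℝ) < N * (1 - ν) ^ N := by
      have : (0 : ℝ) < N := by exact_mod_cast hN0
      positivity
    -- As `toReal` sends `∞` to `0`, the two events agree only up to a null set, by almost sure
    -- finiteness.
    have hset : (P N).real {ω | s < (N : ℝ) * (1 - ν) ^ N * (hittingTimeOf (X N) 0 ω).toReal} =
        (P N).real {ω | ((s / (N * (1 - ν) ^ N)).toNNReal : ℝ≥0∞) < hittingTimeOf (X N) 0 ω} := by
      apply measureReal_congr
      filter_upwards [(hX N).ae_hittingTimeOf_lt_top hν0 hν1 (hC N) (hX0 N)] with ω hω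
      refine propext (Iff.trans ?_ (ENNReal.ofReal_lt_iff_lt_toReal
        (div_nonneg hs hα.le) hω.ne).symm)
      exact (div_lt_iff₀' hα).symm
    rw [hset]
    have h1 := (hX N).hittingTimeOf_tail_bounds hν0 hν1 hN (hC N) (hX0 N)
      (s / (N * (1 - ν) ^ N)).toNNReal
    rw [Real.coe_toNNReal _ (div_nonneg hs hα.le), div_div, div_div] at h1
    have h2 : b N / a N = engsetMeanHitting ν N (C N) (C N) / engsetMeanHitting ν N (C N) 1 :=
      mul_div_mul_left _ _ hα.ne'
    rw [h2]
    exact h1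
  exact tendsto_of_tendsto_of_tendsto_of_le_of_le' (hexp ha) hup
    (hbounds.mono fun _ h => h.1) (hbounds.mono fun _ h => h.2)

theorem IsEngsetProcess.tendstoInDistribution_hittingTimeOf (hν0 : 0 < ν) (hν1 : ν < 1)
    (hC : ∀ N, C N ≤ N) (hX : ∀ N, IsEngsetProcess ν (1 - ν) N (C N) (P N) (X N))
    (hX0 : ∀ N, ∀ᵐ ω ∂(P N), X N 0 ω = Fin.last (C N)) {c : ℝ} (hc : 0 < c)
    (hlim : Tendsto (fun N : ℕ => ∑ k ∈ Finset.range (C N + 1), binomialWeight ν N k) atTop (𝓝 c))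
    {Ω' : Type*} [MeasurableSpace Ω'] (P' : Measure Ω') [IsProbabilityMeasure P'] {Z : Ω' → ℝ}
    (hZ : HasLaw Z (expMeasure (ν / c)) P') :
    TendstoInDistribution
      (fun (N : ℕ) (ω : Ω N) => (N : ℝ) * (1 - ν) ^ N * (hittingTimeOf (X N) 0 ω).toReal)
      atTop Z P P' := by
  have hμ : 0 < 1 - ν := by linarith
  exact tendstoInDistribution_exp_of_tendsto_tail
    (fun N => ((hX N).aemeasurable_hittingTimeOf 0).ennreal_toReal.const_mul _)
    (fun N ω => by positivity) (div_pos hν0 hc)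
    (fun s hs => IsEngsetProcess.tendsto_tail hν0 hν1 hC hX hX0 hc hlim hs) P' hZ

end EngsetLimit

theorem mainTheorem8
    (ν : ℝ) (hν0 : 0 < ν) (hν1 : ν < 1)
    (C : ℕ → ℕ) (hC : ∀ N, C N ≤ N)
    {Ω : ℕ → Type*} [∀ N, MeasurableSpace (Ω N)]
    (P : ∀ N, Measure (Ω N)) [∀ N, IsProbabilityMeasure (P N)]
    (X : ∀ N, ℝ≥0 → Ω N → Fin (C N + 1))
    (hX : ∀ N, IsEngsetProcess ν (1 - ν) N (C N) (P N) (X N))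
    (hX0 : ∀ N, ∀ᵐ ω ∂(P N), X N 0 ω = Fin.last (C N))
    {Ω' : Type*} [MeasurableSpace Ω'] (P' : Measure Ω') [IsProbabilityMeasure P'] :
    -- the hitting times of the empty state are almost surely finite
    (∀ N, ∀ᵐ ω ∂(P N), hittingTimeOf (X N) 0 ω < ∞) ∧
    -- critical case: exponential limit with parameter `2ν`
    ((fun N : ℕ => (C N : ℝ) - ν * N) =o[atTop] (fun N : ℕ => √(N : ℝ)) →
      ∀ Z : Ω' → ℝ, HasLaw Z (expMeasure (2 * ν)) P' →
        TendstoInDistribution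
          (fun (N : ℕ) (ω : Ω N) => (N : ℝ) * (1 - ν) ^ N * (hittingTimeOf (X N) 0 ω).toReal)
          atTop Z P P') ∧
    -- comparison with the sub-critical case: exponential limit with parameter `ν`
    (∀ η : ℝ, ν < η →
      (fun N : ℕ => (C N : ℝ) - η * N) =O[atTop] (fun _ : ℕ => (1 : ℝ)) →
      ∀ Z : Ω' → ℝ, HasLaw Z (expMeasure ν) P' →
        TendstoInDistribution
          (fun (N : ℕ) (ω : Ω N) => (N : ℝ) * (1 - ν) ^ N * (hittingTimeOf (X N) 0 ω).toReal)
          atTop Z P P') := by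
  refine ⟨fun N => (hX N).ae_hittingTimeOf_lt_top hν0 hν1 (hC N) (hX0 N), fun h Z hZ => ?_,
    fun η hη h Z hZ => ?_⟩
  · refine IsEngsetProcess.tendstoInDistribution_hittingTimeOf hν0 hν1 hC hX hX0 one_half_pos
      ?_ P' (by rwa [show ν / (1 / 2) = 2 * ν by ring])
    exact (tendsto_binomial_real_Iic hν0 hν1 h).congr fun N =>
      binomial_real_Iic_eq_sum hν0 hν1 N (C N)
  · exact IsEngsetProcess.tendstoInDistribution_hittingTimeOf hν0 hν1 hC hX hX0 one_pos
      (tendsto_sum_binomialWeight_of_lt hν0 hν1 hC hη h) P' (by rwa [div_one])
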